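/- Theorem. Let $f\in C^2(\mathbb R)$ satisfy (H1): $f(0)=f(1)=0$, $f'(0)<0$, $f'(1)<0$, and $F(u)=\int_0^u f(s)\,ds$ satisfies $F(1)=0$ and $F(u)\neq 0$ for all $u\in(0,1)$. Let $(a_k)_{k\in\mathbb Z}$ be real numbers satisfying (H2): $\sum_{k\in\mathbb Z}a_k=0$, $a_0<0$, $a_k=a_{-k}$ for all $k$, and $\sum_{k\ge 1}|a_k|k^2<\infty$. Then the equation $u''+f(u)=0$ on $\mathbb R$ has a $C^2$ solution $u_0$ with $u_0(-\infty)=0$, $u_0(\infty)=1$. Moreover, for every such $u_0$ there are $C>0$ and $\varepsilon_0>0$ such that for every $\varepsilon\in(0,\varepsilon_0)$ there is a $C^2$ solution $u_\varepsilon$ of $$u''(z)-\varepsilon\sum_{k\in\mathbb Z}a_k\,u(z-k)+f(u(z))=0,\qquad z\in\mathbb R,$$ with $u_\varepsilon-u_0\in H^2(\mathbb R)$ and $\|u_\varepsilon-u_0\|_{H^2(\mathbb R)}\le C\varepsilon$. It satisfies $u_\varepsilon(-\infty)=0$ and $u_\varepsilon(\infty)=1$, so that $u_n(t)=u_\varepsilon(n-t)$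 is a traveling kink of the lattice equation $\ddot u_n-\varepsilon\sum_{k}a_ku_{n-k}+f(u_n)=0$, $n\in\mathbb Z$. In particular the result covers the weakly coupled discrete sine-Gordon and $\phi^4$ lattices: let $c\ne 0$ and let either $g(v)=\sin v$, $\alpha=-\pi$, $\beta=\pi$, or $g(v)=2(v-v^3)$, $\alpha=-1$, $\beta=1$. Then $c^2V''+g(V)=0$ has a $C^2$ solution $V_0$ on $\mathbb R$ with $V_0(-\infty)=\alpha$, $V_0(\infty)=\beta$, and for every such $V_0$ there are $C>0$ and $\kappa_0>0$ such that for every $\kappa\in(0,\kappa_0)$ there is a $C^2$ function $V$ with $V(-\infty)=\alpha$, $V(\infty)=\beta$, $V-V_0\in H^2(\mathbb R)$, $\|V-V_0\|_{H^2(\mathbb R)}\le C\kappa$, such that $v_n(t)=V(n-ct)$ solves $$\ddot v_n-\kappa\,(v_{n+1}-2v_n+v_{n-1})+g(v_n)=0,\qquad n\in\mathbb Z,\ t\in\mathbb R.$$ -/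

import Mathlib

open MeasureTheory Filter Topology
open scoped ENNReal ContDiff

noncomputable section

namespace Kink

/-! ### Weak derivatives and the Sobolev space `H²(ℝ)` -/

/-- `h` is a weak derivative of `g` on the real line. -/
def HasWeakDeriv (g h : ℝ → ℝ) : Prop :=
  LocallyIntegrable g ∧ LocallyIntegrable h ∧
    ∀ φ : ℝ → ℝ, ContDiff ℝ ∞ φ → HasCompactSupport φ →
      ∫ z, deriv φ z * g z = - ∫ z, φ z * h z

/-- `w`, `w₁`, `w₂` are square integrable, `w₁` is the first and `w₂` the second weak derivative
of `w`. -/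
def IsH2Triple (w w₁ w₂ : ℝ → ℝ) : Prop :=
  MemLp w 2 ∧ MemLp w₁ 2 ∧ MemLp w₂ 2 ∧ HasWeakDeriv w w₁ ∧ HasWeakDeriv w₁ w₂

/-- Membership in `H²(ℝ)`. -/
def MemH2 (w : ℝ → ℝ) : Prop := ∃ w₁ w₂ : ℝ → ℝ, IsH2Triple w w₁ w₂

/-- `(‖w‖² + ‖w₁‖² + ‖w₂‖²)^(1/2)` with the norms of `L²(ℝ)`. -/
def tripleNorm (w w₁ w₂ : ℝ → ℝ) : ℝ≥0∞ :=
  (eLpNorm w 2 volume ^ (2 : ℕ) + eLpNorm w₁ 2 volume ^ (2 : ℕ)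
    + eLpNorm w₂ 2 volume ^ (2 : ℕ)) ^ (1 / 2 : ℝ)

/-- The norm of `H²(ℝ)`; it is `∞` outside `H²(ℝ)`. Weak derivatives are unique up to null sets,
so the infimum runs over a single value (see `h2Norm_eq`). -/
def h2Norm (w : ℝ → ℝ) : ℝ≥0∞ :=
  ⨅ (w₁ : ℝ → ℝ) (w₂ : ℝ → ℝ) (_ : IsH2Triple w w₁ w₂), tripleNorm w w₁ w₂

theorem HasWeakDeriv.ae_eq {g g' h h' : ℝ → ℝ} (hg : HasWeakDeriv g h) (hg' : HasWeakDeriv g' h')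
    (e : g =ᵐ[volume] g') : h =ᵐ[volume] h' := by
  refine ae_eq_of_integral_contDiff_smul_eq hg.2.1 hg'.2.1 fun φ hφ hc => ?_
  have h1 := hg.2.2 φ hφ hc
  have h2 := hg'.2.2 φ hφ hc
  have h3 : ∫ z, deriv φ z * g z = ∫ z, deriv φ z * g' z :=
    integral_congr_ae (by filter_upwards [e] with z hz; rw [hz])
  simp only [smul_eq_mul]
  linarith

theorem h2Norm_eq {w w₁ w₂ : ℝ → ℝ} (h : IsH2Triple w w₁ w₂) :
    h2Norm w = tripleNorm w w₁ w₂ := by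
  refine le_antisymm (iInf_le_of_le w₁ (iInf_le_of_le w₂ (iInf_le _ h))) ?_
  refine le_iInf fun v₁ => le_iInf fun v₂ => le_iInf fun h' => le_of_eq ?_
  have e₁ : w₁ =ᵐ[volume] v₁ := h.2.2.2.1.ae_eq h'.2.2.2.1 (ae_eq_refl w)
  have e₂ : w₂ =ᵐ[volume] v₂ := h.2.2.2.2.ae_eq h'.2.2.2.2 e₁
  simp only [tripleNorm, eLpNorm_congr_ae e₁, eLpNorm_congr_ae e₂]

/-! ### Hypotheses -/

/-- The primitive `F` of `f` with `F(0) = 0`. -/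
def primitive (f : ℝ → ℝ) (u : ℝ) : ℝ := ∫ s in (0 : ℝ)..u, f s

/-- Hypothesis (H1) on the nonlinearity. -/
structure H1 (f : ℝ → ℝ) : Prop where
  contDiff : ContDiff ℝ 2 f
  zero : f 0 = 0
  one : f 1 = 0
  deriv_zero : deriv f 0 < 0
  deriv_one : deriv f 1 < 0
  primitive_one : primitive f 1 = 0
  primitive_ne : ∀ u ∈ Set.Ioo (0 : ℝ) 1, primitive f u ≠ 0

/-- Hypothesis (H2) on the coupling coefficients. -/
structure H2 (a : ℤ → ℝ) : Prop where
  sum_eq_zero : HasSum a 0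
  neg : a 0 < 0
  symm : ∀ k : ℤ, a k = a (-k)
  summable : Summable fun k : ℕ => |a (k : ℤ)| * (k : ℝ) ^ 2

/-! ### Equations -/

/-- `V(-∞) = α` and `V(∞) = β`. -/
def Connects (α β : ℝ) (V : ℝ → ℝ) : Prop :=
  Tendsto V atBot (𝓝 α) ∧ Tendsto V atTop (𝓝 β)

/-- `u` is a (classical) solution of `u'' - ε ∑ₖ aₖ u(z - k) + f(u) = 0` on the real line. -/
def SolvesNonlocal (a : ℤ → ℝ) (f : ℝ → ℝ) (ε : ℝ) (u : ℝ → ℝ) : Prop :=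
  ContDiff ℝ 2 u ∧ ∀ z : ℝ, Summable (fun k : ℤ => a k * u (z - k)) ∧
    deriv (deriv u) z - ε * (∑' k : ℤ, a k * u (z - k)) + f (u z) = 0

/-- `V` is a heteroclinic solution, from `α` to `β`, of `c² V'' + g(V) = 0`. -/
def IsHeteroclinic (g : ℝ → ℝ) (c α β : ℝ) (V : ℝ → ℝ) : Prop :=
  ContDiff ℝ 2 V ∧ (∀ z : ℝ, c ^ 2 * deriv (deriv V) z + g (V z) = 0) ∧ Connects α β V

/-- `v` solves the lattice equation `v̈ₙ - ε ∑ₖ aₖ vₙ₋ₖ + g(vₙ) = 0`, `n ∈ ℤ`. -/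
def SolvesLattice (a : ℤ → ℝ) (g : ℝ → ℝ) (ε : ℝ) (v : ℤ → ℝ → ℝ) : Prop :=
  ∀ n : ℤ, ContDiff ℝ 2 (v n) ∧ ∀ t : ℝ, Summable (fun k : ℤ => a k * v (n - k) t) ∧
    deriv (deriv (v n)) t - ε * (∑' k : ℤ, a k * v (n - k) t) + g (v n t) = 0

/-- `v` solves the lattice equation with nearest neighbour coupling of strength `κ`,
`v̈ₙ - κ (vₙ₊₁ - 2 vₙ + vₙ₋₁) + g(vₙ) = 0`, `n ∈ ℤ`. -/
def SolvesNearestNeighbour (g : ℝ → ℝ) (κ : ℝ) (v : ℤ → ℝ → ℝ) : Prop :=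
  ∀ n : ℤ, ContDiff ℝ 2 (v n) ∧ ∀ t : ℝ,
    deriv (deriv (v n)) t - κ * (v (n + 1) t - 2 * v n t + v (n - 1) t) + g (v n t) = 0

/-- The traveling wave `vₙ(t) = V(n - c t)` with profile `V` and speed `c`. -/
def wave (c : ℝ) (V : ℝ → ℝ) : ℤ → ℝ → ℝ := fun n t => V (n - c * t)

/-- Weakly coupled nearest neighbour lattices with on-site force `g` have traveling kinks from
`α` to `β` of speed `c`: there is a kink profile without coupling, and near each such profile
there are, for small coupling `κ > 0`, kink profiles for the coupled lattice, at a distance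
`O(κ)` in `H²(ℝ)`. -/
def HasWeakCouplingKinks (g : ℝ → ℝ) (α β c : ℝ) : Prop :=
  (∃ V₀ : ℝ → ℝ, IsHeteroclinic g c α β V₀) ∧
  ∀ V₀ : ℝ → ℝ, IsHeteroclinic g c α β V₀ →
    ∃ C > (0 : ℝ), ∃ κ₀ > (0 : ℝ), ∀ κ ∈ Set.Ioo 0 κ₀, ∃ V : ℝ → ℝ,
      ContDiff ℝ 2 V ∧ Connects α β V ∧ SolvesNearestNeighbour g κ (wave c V) ∧
      MemH2 (fun z => V z - V₀ z) ∧ h2Norm (fun z => V z - V₀ z) ≤ ENNReal.ofReal (C * κ)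

end Kink

end

/-!
The unperturbed kink `u₀` is the heteroclinic orbit of `u'' + f(u) = 0` on the energy level
`u'²/2 + F(u) = 0`. In the logistic coordinate `u = σ(y)` the equation `u' = √(-2F(u))` becomes
`y' = b(y)` with `b` positive, continuous and bounded, and is solved by inverting `∫ 1/b`
(`H1.exists_isHeteroclinic`). Conversely, every kink has energy zero, stays in `(0, 1)`, and has a
positive derivative `p = u₀'` which decays exponentially together with its derivative, with ratios
`p(s)/p(z)` controlled on each half-line (`IsHeteroclinic.exists_isWeight`).

The kinks of the coupled equation are found by Lyapunov-Schmidt reduction. The linearization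
`L w = w'' + f'(u₀) w` has the kernel element `p`, so it factorizes as
`(d/dz + p'/p)(d/dz - p'/p)`, and for `h` orthogonal to `p` the equation `L w = h` is solved by two
explicit integrations. The ratio bounds dominate both by convolution with an exponential kernel,
so that the solution operator is bounded in the uniform norm and in `L²(ℝ)`
(`IsWeight.exists_resolvent_bounds`). With `S u = ∑ₖ aₖ u(· - k)`, the equation for `u = u₀ + w`
reads `L w = ε S u₀ + ε S w - N(w)` with a quadratic remainder `N`. Here `S u₀` lies in `L²(ℝ)`
because `∑ₖ aₖ = 0`, `∑ₖ |aₖ| |k| < ∞` and translations satisfy `‖u₀(· - k) - u₀‖ ≤ |k| ‖p‖`. The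
equation projected along `p` is solved by contraction in the uniform metric on a set of functions
bounded by `O(ε)` in both norms (`exists_correction`). This leaves `u'' - ε S u + f(u) = -l p` with
an unknown number `l`.

The number `l` vanishes, so no nondegeneracy condition is needed: multiplied by `u'` and integrated,
`u'' + f(u)` gives the increment of the energy, which is zero, and `S u` gives zero since
`aₖ = a₋ₖ` and `(u(z + k) - u(z)) (u'(z + k) - u'(z))` is a total derivative, while
`∫ p u' = ∫ p² + O(ε) ≠ 0` (`multiplier_eq_zero`).

The two classical lattices follow by an affine change of the dependent variable and the
coefficients `1, -2, 1` with `ε = κ/c²`.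
-/

noncomputable section

namespace Kink

/-! ### The potential and the existence of the uncoupled kink -/

theorem hasDerivAt_primitive {f : ℝ → ℝ} (hf : Continuous f) (u : ℝ) :
    HasDerivAt (primitive f) (f u) u :=
  intervalIntegral.integral_hasDerivAt_right (hf.intervalIntegrable _ _)
    (hf.stronglyMeasurableAtFilter _ _) hf.continuousAt

theorem primitive_zero (f : ℝ → ℝ) : primitive f 0 = 0 := by simp [primitive]

theorem abs_le_mul_sq_of_hasDerivAt {G g : ℝ → ℝ} {e u K : ℝ} (hG : ∀ x, HasDerivAt G (g x) x)
    (he : G e = 0) (hK : 0 ≤ K) (hg : ∀ x ∈ Set.uIcc e u, |g x| ≤ K * |x - e|) :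
    |G u| ≤ K * (u - e) ^ 2 := by
  have h := (convex_uIcc e u).norm_image_sub_le_of_norm_hasDerivWithin_le (f := G) (f' := g)
    (C := K * |u - e|) (fun x _ => (hG x).hasDerivWithinAt)
    (fun x hx => (hg x hx).trans (mul_le_mul_of_nonneg_left ?_ hK))
    Set.left_mem_uIcc Set.right_mem_uIcc
  · rw [he, sub_zero, Real.norm_eq_abs, Real.norm_eq_abs] at h
    calc |G u| ≤ K * |u - e| * |u - e| := h
      _ = K * (u - e) ^ 2 := by rw [mul_assoc, abs_mul_abs_self]; ring
  · exact Set.abs_sub_left_of_mem_uIcc hx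

theorem exists_abs_le_mul_sq {F f : ℝ → ℝ} (hf : ContDiff ℝ 1 f) (hF : ∀ x, HasDerivAt F (f x) x)
    {e a b : ℝ} (he : e ∈ Set.Icc a b) (fe : f e = 0) (Fe : F e = 0) :
    ∃ K > 0, ∀ u ∈ Set.Icc a b, |F u| ≤ K * (u - e) ^ 2 := by
  obtain ⟨K, hK⟩ := isCompact_Icc.exists_bound_of_continuousOn
    (hf.continuous_deriv le_rfl).continuousOn (s := Set.Icc a b)
  refine ⟨|K| + 1, by positivity, fun u hu => ?_⟩
  refine abs_le_mul_sq_of_hasDerivAt hF Fe (by positivity) fun x hx => ?_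
  have hx' : x ∈ Set.Icc a b := Set.ordConnected_Icc.uIcc_subset he hu hx
  have h := (convex_Icc a b).norm_image_sub_le_of_norm_deriv_le (f := f) (C := |K| + 1)
    (fun y _ => (hf.differentiable one_ne_zero) y)
    (fun y hy => (hK y hy).trans (by linarith [le_abs_self K])) he hx'
  simpa [fe] using h

/-- Near a nondegenerate maximum `e` of `F` at height `0`, the function `f² = F'²` is comparable
with `-2F`. On an orbit of energy zero the latter is `u'²`, so that `u''` is comparable with `u'`:
this is the source of all exponential estimates. -/
theorem eventually_nondegenerate {F f : ℝ → ℝ} (hf : ContDiff ℝ 1 f)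
    (hF : ∀ x, HasDerivAt F (f x) x) {e : ℝ} (fe : f e = 0) (Fe : F e = 0) (hm : deriv f e < 0) :
    ∃ μ > 0, ∃ Q > 0, ∀ᶠ u in 𝓝 e, μ ^ 2 * (-2 * F u) ≤ f u ^ 2 ∧ f u ^ 2 ≤ Q ^ 2 * (-2 * F u) ∧
      (u ≠ e → F u < 0) ∧ (u < e → 0 < f u) ∧ (e < u → f u < 0) := by
  set m := -deriv f e with hmdef
  have m0 : 0 < m := by linarith
  refine ⟨√(3 * m / 8), by positivity, √(25 * m / 8), by positivity, ?_⟩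
  have hd : HasDerivAt f (-m) e := by
    rw [hmdef, neg_neg]; exact (hf.differentiable one_ne_zero e).hasDerivAt
  -- With relative error `1/4` in `f u ≈ -m (u - e)`, integration gives `F u ≈ -m (u - e)² / 2` with
  -- relative error `1/2`, so that `F u` keeps a definite sign.
  have ho := (hasDerivAt_iff_isLittleO.1 hd).def (show 0 < m / 4 by positivity)
  rw [Metric.eventually_nhds_iff_ball] at ho ⊢
  obtain ⟨δ, δ0, hδ⟩ := ho
  refine ⟨δ, δ0, fun u hu => ?_⟩
  have key : ∀ x ∈ Metric.ball e δ, |f x + m * (x - e)| ≤ m / 4 * |x - e| := fun x hx => by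
    have := hδ x hx
    simpa [fe, mul_comm] using this
  have hG := abs_le_mul_sq_of_hasDerivAt (G := fun x => F x + m / 2 * (x - e) ^ 2)
    (g := fun x => f x + m * (x - e)) (e := e) (u := u) (K := m / 4)
    (fun x => by
      have h := (hF x).add ((((hasDerivAt_id' x).sub_const e).pow 2).const_mul (m / 2))
      exact h.congr_deriv (by simp; ring)) (by simp [Fe]) (by positivity)
    (fun x hx => key x (((convex_ball e δ).ordConnected.uIcc_subset
      (Metric.mem_ball_self δ0) hu) hx))
  have k := key u hu
  rw [Real.sq_sqrt (by positivity), Real.sq_sqrt (by positivity)]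
  rw [abs_le] at hG k
  obtain ⟨g1, g2⟩ := hG
  have hs := sq_abs (u - e)
  rcases lt_trichotomy u e with h | h | h
  · rw [abs_of_neg (by linarith)] at k
    have hp : 0 < e - u := by linarith
    have f1 : 3 * m / 4 * (e - u) ≤ f u := by linarith
    have f2 : f u ≤ 5 * m / 4 * (e - u) := by linarith
    have f0 : 0 < f u := lt_of_lt_of_le (by positivity) f1
    have q1 := pow_le_pow_left₀ (by positivity) f1 2
    have q2 := pow_le_pow_left₀ f0.le f2 2
    refine ⟨?_, ?_, fun _ => ?_, fun _ => f0, fun h' => absurd h (by linarith)⟩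
    · nlinarith
    · nlinarith
    · nlinarith [mul_pos m0 (pow_pos hp 2)]
  · subst h; simp [fe, Fe]
  · rw [abs_of_pos (by linarith)] at k
    have hp : 0 < u - e := by linarith
    have f1 : 3 * m / 4 * (u - e) ≤ -f u := by linarith
    have f2 : -f u ≤ 5 * m / 4 * (u - e) := by linarith
    have f0 : 0 < -f u := lt_of_lt_of_le (by positivity) f1
    have q1 := pow_le_pow_left₀ (by positivity) f1 2
    have q2 := pow_le_pow_left₀ f0.le f2 2
    refine ⟨?_, ?_, fun _ => ?_, fun h' => absurd h (by linarith), fun _ => by linarith⟩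
    · nlinarith
    · nlinarith
    · nlinarith [mul_pos m0 (pow_pos hp 2)]

/-- The primitive is negative next to `0`, and has no zero in `(0, 1)` by assumption. -/
theorem H1.primitive_neg {f : ℝ → ℝ} (hf : H1 f) {u : ℝ} (hu : u ∈ Set.Ioo (0 : ℝ) 1) :
    primitive f u < 0 := by
  have hc := hf.contDiff.continuous
  obtain ⟨_, _, _, _, hev⟩ := eventually_nondegenerate (hf.contDiff.of_le one_le_two)
    (hasDerivAt_primitive hc) hf.zero (primitive_zero f) hf.deriv_zero
  have hev' : ∀ᶠ x in 𝓝[>] (0 : ℝ), x ∈ Set.Ioo (0 : ℝ) 1 ∧ primitive f x < 0 := by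
    filter_upwards [hev.filter_mono nhdsWithin_le_nhds, Ioo_mem_nhdsGT (zero_lt_one (α := ℝ))]
      with x hx hx'
    exact ⟨hx', hx.2.2.1 hx'.1.ne'⟩
  obtain ⟨x, hx, hneg⟩ := hev'.exists
  by_contra hcon
  have hcont : ContinuousOn (primitive f) (Set.Ioo 0 1) :=
    fun y _ => (hasDerivAt_primitive hc y).continuousAt.continuousWithinAt
  obtain ⟨y, hy, h0⟩ := (isPreconnected_Ioo.image _ hcont).ordConnected.out
    (Set.mem_image_of_mem _ hx) (Set.mem_image_of_mem _ hu) ⟨hneg.le, not_lt.1 hcon⟩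
  exact hf.primitive_ne y hy h0

/-- A scalar autonomous equation with positive bounded continuous right-hand side has a solution
on the whole line, which runs from `-∞` to `∞`: the inverse function of `∫ 1/b`. -/
theorem exists_autonomous_solution {b : ℝ → ℝ} (hb : Continuous b) {B : ℝ} (h0 : ∀ y, 0 < b y)
    (hB : ∀ y, b y ≤ B) :
    ∃ y : ℝ → ℝ, (∀ z, HasDerivAt y (b (y z)) z) ∧ Tendsto y atBot atBot ∧
      Tendsto y atTop atTop := by
  have B0 : 0 < B := (h0 0).trans_le (hB 0)
  have hc : Continuous fun y => (b y)⁻¹ := hb.inv₀ fun y => (h0 y).ne'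
  set Y : ℝ → ℝ := primitive fun y => (b y)⁻¹ with hY
  have hd : ∀ y, HasDerivAt Y (b y)⁻¹ y := hasDerivAt_primitive hc
  have hmono : StrictMono Y := strictMono_of_hasDerivAt_pos hd fun y => inv_pos.2 (h0 y)
  have hlin : Monotone fun y => Y y - B⁻¹ * y := by
    have hd' : ∀ y, HasDerivAt (fun y => Y y - B⁻¹ * y) ((b y)⁻¹ - B⁻¹ * 1) y := fun y =>
      (hd y).sub ((hasDerivAt_id' y).const_mul _)
    refine monotone_of_deriv_nonneg (fun y => (hd' y).differentiableAt) fun y => ?_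
    rw [(hd' y).deriv, mul_one]
    exact sub_nonneg.2 (inv_anti₀ (h0 y) (hB y))
  have Y0 : Y 0 = 0 := primitive_zero _
  have htop : Tendsto Y atTop atTop := by
    refine tendsto_atTop_mono' _ ?_ (tendsto_id.const_mul_atTop (inv_pos.2 B0))
    filter_upwards [eventually_ge_atTop 0] with y hy
    have := hlin hy
    simp only [Y0, id] at *; linarith
  have hbot : Tendsto Y atBot atBot := by
    refine tendsto_atBot_mono' _ ?_ (tendsto_id.const_mul_atBot (inv_pos.2 B0))
    filter_upwards [eventually_le_atBot 0] with y hy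
    have := hlin hy
    simp only [Y0, id] at *; linarith
  have hcY : Continuous Y := continuous_iff_continuousAt.2 fun y => (hd y).continuousAt
  let e : ℝ ≃o ℝ := hmono.orderIsoOfSurjective Y (hcY.surjective htop hbot)
  have he : ∀ z, Y (e.symm z) = z := fun z => e.apply_symm_apply z
  refine ⟨e.symm, fun z => ?_, e.symm.tendsto_atBot, e.symm.tendsto_atTop⟩
  have := HasDerivAt.of_local_left_inverse (f := Y) (g := e.symm) (a := z)
    e.symm.continuous.continuousAt (hd _) (inv_pos.2 (h0 _)).ne' (Eventually.of_forall he)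
  simpa using this

theorem contDiff_two_of_hasDerivAt {u u' u'' : ℝ → ℝ} (h : ∀ z, HasDerivAt u (u' z) z)
    (h' : ∀ z, HasDerivAt u' (u'' z) z) (hc : Continuous u'') : ContDiff ℝ 2 u := by
  have e1 : deriv u = u' := funext fun z => (h z).deriv
  have e2 : deriv u' = u'' := funext fun z => (h' z).deriv
  rw [show (2 : WithTop ℕ∞) = 1 + 1 from rfl, contDiff_succ_iff_deriv]
  refine ⟨fun z => (h z).differentiableAt, by simp, ?_⟩
  rw [e1, contDiff_one_iff_deriv, e2]
  exact ⟨fun z => (h' z).differentiableAt, hc⟩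

/-- The uncoupled equation has a kink: in the logistic coordinate `u = σ(y)` the first order
equation `u' = √(-2F(u))` becomes `y' = b(y)` with `b` positive and bounded. -/
theorem H1.exists_isHeteroclinic {f : ℝ → ℝ} (hf : H1 f) : ∃ u₀, IsHeteroclinic f 1 0 1 u₀ := by
  have hc := hf.contDiff.continuous
  have hF := hasDerivAt_primitive hc
  have hFc : Continuous (primitive f) := continuous_iff_continuousAt.2 fun y => (hF y).continuousAt
  obtain ⟨K, K0, hK⟩ := exists_abs_le_mul_sq (hf.contDiff.of_le one_le_two) hF
    (Set.left_mem_Icc.2 zero_le_one) hf.zero (primitive_zero f)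
  obtain ⟨K', K0', hK'⟩ := exists_abs_le_mul_sq (hf.contDiff.of_le one_le_two) hF
    (Set.right_mem_Icc.2 zero_le_one) hf.one hf.primitive_one
  set σ := Real.sigmoid
  have s0 := Real.sigmoid_pos
  have s1 := Real.sigmoid_lt_one
  have hneg : ∀ y, primitive f (σ y) < 0 := fun y => hf.primitive_neg ⟨s0 y, s1 y⟩
  set g : ℝ → ℝ := fun u => √(-2 * primitive f u)
  set b : ℝ → ℝ := fun y => g (σ y) / (σ y * (1 - σ y)) with hbdef
  have hden : ∀ y, 0 < σ y * (1 - σ y) := fun y => mul_pos (s0 y) (by linarith [s1 y])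
  have hσc : Continuous σ := continuous_sigmoid
  have hb : Continuous b := by
    refine Continuous.div ?_ (by fun_prop) fun y => (hden y).ne'
    exact Real.continuous_sqrt.comp (by fun_prop)
  have b0 : ∀ y, 0 < b y := fun y =>
    div_pos (Real.sqrt_pos.2 (by linarith [hneg y])) (hden y)
  have bB : ∀ y, b y ≤ √(8 * (K + K')) := fun y => by
    rw [hbdef, div_le_iff₀ (hden y)]
    refine Real.sqrt_le_iff.2 ⟨mul_nonneg (Real.sqrt_nonneg _) (hden y).le, ?_⟩
    rw [mul_pow, Real.sq_sqrt (by positivity)]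
    have m := s0 y
    have m' := s1 y
    have a1 := (abs_le.1 (hK (σ y) ⟨m.le, m'.le⟩)).1
    have a2 := (abs_le.1 (hK' (σ y) ⟨m.le, m'.le⟩)).1
    -- The quadratic bound at the nearer endpoint suffices, the other endpoint being at distance
    -- at least `1/2`.
    rcases le_total (σ y) (1 / 2) with h | h
    · have h1 : 1 / 4 ≤ (1 - σ y) ^ 2 := by nlinarith
      have h2 : (σ y) ^ 2 * (1 / 4) ≤ (σ y * (1 - σ y)) ^ 2 := by
        rw [mul_pow]; exact mul_le_mul_of_nonneg_left h1 (sq_nonneg _)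
      have h3 := mul_le_mul_of_nonneg_left h2 (show 0 ≤ 8 * K by positivity)
      have h4 : 0 ≤ 8 * K' * (σ y * (1 - σ y)) ^ 2 := by positivity
      nlinarith
    · have h1 : 1 / 4 ≤ (σ y) ^ 2 := by nlinarith
      have h2 : 1 / 4 * (1 - σ y) ^ 2 ≤ (σ y * (1 - σ y)) ^ 2 := by
        rw [mul_pow]; exact mul_le_mul_of_nonneg_right h1 (sq_nonneg _)
      have h3 := mul_le_mul_of_nonneg_left h2 (show 0 ≤ 8 * K' by positivity)
      have h4 : 0 ≤ 8 * K * (σ y * (1 - σ y)) ^ 2 := by positivity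
      nlinarith
  obtain ⟨y, hy, ybot, ytop⟩ := exists_autonomous_solution hb b0 bB
  have d1 : ∀ z, HasDerivAt (fun z => σ (y z)) (g (σ (y z))) z := fun z => by
    have h := (Real.hasDerivAt_sigmoid (y z)).comp z (hy z)
    have e : σ (y z) * (1 - σ (y z)) * b (y z) = g (σ (y z)) :=
      mul_div_cancel₀ _ (hden (y z)).ne'
    exact e ▸ h
  have d2 : ∀ z, HasDerivAt (fun z => g (σ (y z))) (-f (σ (y z))) z := fun z => by
    have hpos : 0 < g (σ (y z)) := Real.sqrt_pos.2 (by linarith [hneg (y z)])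
    have h := (((hF (σ (y z))).comp z (d1 z)).const_mul (-2)).sqrt
      (by simpa using (hneg (y z)).ne)
    refine h.congr_deriv ?_
    change -2 * (f (σ (y z)) * g (σ (y z))) / (2 * g (σ (y z))) = _
    field_simp
  have yc : Continuous y := continuous_iff_continuousAt.2 fun z => (hy z).continuousAt
  refine ⟨fun z => σ (y z), contDiff_two_of_hasDerivAt d1 d2 (by fun_prop), fun z => ?_,
    Real.tendsto_sigmoid_atBot.comp ybot, Real.tendsto_sigmoid_atTop.comp ytop⟩
  rw [show deriv (fun z => σ (y z)) = fun z => g (σ (y z)) from funext fun z => (d1 z).deriv,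
    (d2 z).deriv]
  ring

/-! ### Properties of the uncoupled kink -/

/-- A positive weight on the line with a bounded logarithmic derivative, decaying exponentially
away from the origin on either half-line: for `s` beyond `z`, as seen from the origin,
`p s / p z ≤ M exp (-μ |s - z|)`. -/
structure IsWeight (p p' : ℝ → ℝ) (M μ Q : ℝ) : Prop where
  M_pos : 0 < M
  rate_pos : 0 < μ
  Q_pos : 0 < Q
  pos : ∀ z, 0 < p z
  hasDerivAt : ∀ z, HasDerivAt p (p' z) z
  continuous_deriv : Continuous p'
  abs_deriv_le : ∀ z, |p' z| ≤ Q * p z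
  right : ∀ z s, 0 ≤ z → z ≤ s → p s ≤ M * Real.exp (-μ * (s - z)) * p z
  left : ∀ z s, z ≤ 0 → s ≤ z → p s ≤ M * Real.exp (-μ * (z - s)) * p z

/-- A differential inequality near `∞` gives exponential decay on a half-line: `p z * exp (μ z)` is
eventually decreasing, and on a compact interval it lies between positive constants. -/
theorem exists_decay {p p' : ℝ → ℝ} {μ : ℝ} (hp : ∀ z, 0 < p z)
    (hd : ∀ z, HasDerivAt p (p' z) z) (hev : ∀ᶠ z in atTop, p' z ≤ -μ * p z) :
    ∃ M > 0, ∀ z s, 0 ≤ z → z ≤ s → p s ≤ M * Real.exp (-μ * (s - z)) * p z := by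
  obtain ⟨Z, hZ⟩ := (hev.and (eventually_ge_atTop 0)).exists_forall_of_atTop
  have Z0 : 0 ≤ Z := (hZ Z le_rfl).2
  set m : ℝ → ℝ := fun z => p z * Real.exp (μ * z)
  have m0 : ∀ z, 0 < m z := fun z => mul_pos (hp z) (Real.exp_pos _)
  have md : ∀ z, HasDerivAt m ((p' z + μ * p z) * Real.exp (μ * z)) z := fun z => by
    have h := (hd z).mul (((hasDerivAt_id' z).const_mul μ).exp)
    exact h.congr_deriv (by ring)
  have mc : Continuous m := continuous_iff_continuousAt.2 fun z => (md z).continuousAt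
  have anti : AntitoneOn m (Set.Ici Z) := by
    refine antitoneOn_of_deriv_nonpos (convex_Ici Z) mc.continuousOn
      (fun z _ => (md z).differentiableAt.differentiableWithinAt) fun z hz => ?_
    rw [interior_Ici] at hz
    rw [(md z).deriv]
    exact mul_nonpos_of_nonpos_of_nonneg (by linarith [(hZ z hz.le).1]) (Real.exp_pos _).le
  obtain ⟨x, hx, hmin⟩ := isCompact_Icc.exists_isMinOn (Set.nonempty_Icc.2 Z0) mc.continuousOn
  obtain ⟨y, hy, hmax⟩ := isCompact_Icc.exists_isMaxOn (Set.nonempty_Icc.2 Z0) mc.continuousOn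
  have hxy : 1 ≤ m y / m x := (one_le_div (m0 x)).2 (hmax hx)
  have key : ∀ z s, 0 ≤ z → z ≤ s → m s ≤ m y / m x * m z := fun z s hz hs => by
    rcases le_total Z z with h | h
    · calc m s ≤ m z := anti h (h.trans hs) hs
        _ ≤ m y / m x * m z := le_mul_of_one_le_left (m0 z).le hxy
    · have h1 : m s ≤ m y := by
        rcases le_total s Z with h' | h'
        · exact hmax ⟨hz.trans hs, h'⟩
        · exact (anti Set.self_mem_Ici h' h').trans (hmax ⟨Z0, le_rfl⟩)
      calc m s ≤ m y := h1
        _ = m y / m x * m x := (div_mul_cancel₀ _ (m0 x).ne').symm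
        _ ≤ m y / m x * m z :=
          mul_le_mul_of_nonneg_left (hmin ⟨hz, h⟩) (zero_le_one.trans hxy)
  refine ⟨m y / m x, div_pos (m0 y) (m0 x), fun z s hz hs => ?_⟩
  have h := mul_le_mul_of_nonneg_right (key z s hz hs) (Real.exp_pos (-(μ * s))).le
  have e1 : m s * Real.exp (-(μ * s)) = p s := by
    simp only [m]; rw [mul_assoc, ← Real.exp_add]; simp
  have e2 : m z * Real.exp (-(μ * s)) = Real.exp (-μ * (s - z)) * p z := by
    simp only [m]; rw [mul_assoc, ← Real.exp_add, mul_comm]; congr 2; ring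
  rwa [e1, mul_assoc, e2, ← mul_assoc] at h

theorem exists_bound_of_eventually {r : ℝ → ℝ} (hr : Continuous r) {a b : ℝ}
    (ha : ∀ᶠ z in atBot, r z ≤ a) (hb : ∀ᶠ z in atTop, r z ≤ b) : ∃ Q > 0, ∀ z, r z ≤ Q := by
  obtain ⟨A, hA⟩ := eventually_atBot.1 ha
  obtain ⟨B, hB⟩ := eventually_atTop.1 hb
  obtain ⟨K, hK⟩ := isCompact_Icc.exists_bound_of_continuousOn hr.continuousOn (s := Set.Icc A B)
  refine ⟨|a| + |b| + |K| + 1, by positivity, fun z => ?_⟩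
  have h1 := abs_nonneg a
  have h2 := abs_nonneg b
  have h3 := abs_nonneg K
  rcases le_total z A with h | h
  · linarith [hA z h, le_abs_self a]
  rcases le_total B z with h' | h'
  · linarith [hB z h', le_abs_self b]
  · linarith [hK z ⟨h, h'⟩, le_abs_self K, Real.le_norm_self (r z)]

section Heteroclinic

variable {f u : ℝ → ℝ}

theorem IsHeteroclinic.hasDerivAt (h : IsHeteroclinic f 1 0 1 u) (z : ℝ) :
    HasDerivAt u (deriv u z) z :=
  (h.1.differentiable two_ne_zero z).hasDerivAt

theorem IsHeteroclinic.hasDerivAt_deriv (h : IsHeteroclinic f 1 0 1 u) (z : ℝ) :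
    HasDerivAt (deriv u) (-f (u z)) z := by
  have h1 : ContDiff ℝ 1 (deriv u) := h.1.deriv' (n := 1)
  have h2 := (h1.differentiable one_ne_zero z).hasDerivAt
  have h3 := h.2.1 z
  exact h2.congr_deriv (by linarith)

/-- The energy `u'²/2 + F(u)` of a kink vanishes: it is constant, and `u'` tends to `0` along a
sequence. -/
theorem IsHeteroclinic.sq_deriv (hf : H1 f) (h : IsHeteroclinic f 1 0 1 u) (z : ℝ) :
    deriv u z ^ 2 = -2 * primitive f (u z) := by
  have hF := hasDerivAt_primitive hf.contDiff.continuous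
  set E : ℝ → ℝ := fun z => deriv u z ^ 2 + 2 * primitive f (u z) with hE
  have dE : ∀ z, HasDerivAt E 0 z := fun z => by
    have h1 := ((h.hasDerivAt_deriv z).pow 2).add
      (((hF (u z)).comp z (h.hasDerivAt z)).const_mul 2)
    exact h1.congr_deriv (by simp; ring)
  have cE : ∀ z, E z = E 0 := fun z =>
    is_const_of_deriv_eq_zero (fun z => (dE z).differentiableAt) (fun z => (dE z).deriv) z 0
  have hξ : ∀ n : ℕ, ∃ ξ ∈ Set.Ioo (n : ℝ) (n + 1), deriv u ξ = u (n + 1) - u n := fun n => by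
    obtain ⟨ξ, h1, h2⟩ := exists_hasDerivAt_eq_slope u (deriv u) (lt_add_one (n : ℝ))
      h.1.continuous.continuousOn fun x _ => h.hasDerivAt x
    exact ⟨ξ, h1, by simpa using h2⟩
  choose ξ hξ1 hξ2 using hξ
  have hn : Tendsto (fun n : ℕ => (n : ℝ)) atTop atTop := tendsto_natCast_atTop_atTop
  have ht : Tendsto ξ atTop atTop := tendsto_atTop_mono (fun n => (hξ1 n).1.le) hn
  have l1 : Tendsto (fun n => deriv u (ξ n)) atTop (𝓝 0) := by
    have h1 := (h.2.2.2.comp (tendsto_atTop_add_const_right _ (1 : ℝ) hn)).sub (h.2.2.2.comp hn)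
    rw [sub_self] at h1
    exact h1.congr fun n => (hξ2 n).symm
  have l2 : Tendsto (fun n => primitive f (u (ξ n))) atTop (𝓝 0) := by
    have h1 := (hF 1).continuousAt.tendsto.comp (h.2.2.2.comp ht)
    rwa [hf.primitive_one] at h1
  have l3 : Tendsto (fun n => E (ξ n)) atTop (𝓝 0) := by
    simpa using (l1.pow 2).add (l2.const_mul 2)
  have E0 : E 0 = 0 := tendsto_nhds_unique (tendsto_const_nhds.congr fun n => (cE (ξ n)).symm) l3
  have := cE z
  rw [E0] at this
  simp only [hE] at this
  linarith

/-- By the energy identity a kink satisfies `|u'| ≤ K |u - e|` next to a zero `e` of energy zero.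
Gronwall's inequality then forbids it to reach `e`. -/
theorem IsHeteroclinic.abs_deriv_le (hf : H1 f) (h : IsHeteroclinic f 1 0 1 u) {e : ℝ}
    (fe : f e = 0) (Fe : primitive f e = 0) (a b : ℝ) :
    ∃ K, ∀ z ∈ Set.Icc a b, |deriv u z| ≤ K * |u z - e| := by
  obtain ⟨R, hR⟩ := isCompact_Icc.exists_bound_of_continuousOn
    h.1.continuous.continuousOn (s := Set.Icc a b)
  obtain ⟨K, K0, hK⟩ := exists_abs_le_mul_sq (e := e) (a := min (-R) e) (b := max R e)
    (hf.contDiff.of_le one_le_two) (hasDerivAt_primitive hf.contDiff.continuous)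
    ⟨min_le_right _ _, le_max_right _ _⟩ fe Fe
  refine ⟨√(2 * K), fun z hz => ?_⟩
  have h1 := abs_le.1 (hR z hz)
  have h2 := (abs_le.1 (hK (u z) ⟨(min_le_left _ _).trans h1.1, h1.2.trans (le_max_left _ _)⟩)).1
  have h3 := h.sq_deriv hf z
  refine abs_le_of_sq_le_sq ?_ (by positivity)
  rw [mul_pow, Real.sq_sqrt (by positivity), sq_abs]
  linarith

theorem IsHeteroclinic.ne_zero (hf : H1 f) (h : IsHeteroclinic f 1 0 1 u) (z : ℝ) : u z ≠ 0 := by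
  intro hz
  have key : ∀ b, z ≤ b → u b = 0 := fun b hb => by
    obtain ⟨K, hK⟩ := h.abs_deriv_le hf hf.zero (primitive_zero f) z b
    refine eq_zero_of_abs_deriv_le_mul_abs_self_of_eq_zero_right h.1.continuous.continuousOn
      (fun x _ => (h.hasDerivAt x).hasDerivWithinAt) hz (K := K) (fun x hx => ?_) b ⟨hb, le_rfl⟩
    simpa using hK x ⟨hx.1, hx.2.le⟩
  refine zero_ne_one (tendsto_nhds_unique (tendsto_const_nhds.congr' ?_) h.2.2.2)
  filter_upwards [eventually_ge_atTop z] with b hb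
  exact (key b hb).symm

theorem IsHeteroclinic.ne_one (hf : H1 f) (h : IsHeteroclinic f 1 0 1 u) (z : ℝ) : u z ≠ 1 := by
  intro hz
  have key : ∀ b, b ≤ z → u b = 1 := fun b hb => by
    obtain ⟨K, hK⟩ := h.abs_deriv_le hf hf.one hf.primitive_one b z
    have hd : ∀ x, HasDerivAt (fun x => u (-x) - 1) (-deriv u (-x)) x := fun x => by
      simpa using ((h.hasDerivAt (-x)).scomp x (hasDerivAt_neg x)).sub_const 1
    have := eq_zero_of_abs_deriv_le_mul_abs_self_of_eq_zero_right
      (f := fun x => u (-x) - 1) (a := -z) (b := -b)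
      (fun x _ => (hd x).continuousAt.continuousWithinAt)
      (fun x _ => (hd x).hasDerivWithinAt) (by simp [hz]) (K := K) (fun x hx => ?_) (-b)
      ⟨neg_le_neg hb, le_rfl⟩
    · simpa [sub_eq_zero] using this
    · simpa using hK (-x) ⟨by linarith [hx.2], by linarith [hx.1]⟩
  refine zero_ne_one (tendsto_nhds_unique h.2.2.1 (tendsto_const_nhds.congr' ?_))
  filter_upwards [eventually_le_atBot z] with b hb
  exact (key b hb).symm

theorem IsHeteroclinic.mem_Ioo (hf : H1 f) (h : IsHeteroclinic f 1 0 1 u) (z : ℝ) :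
    u z ∈ Set.Ioo (0 : ℝ) 1 := by
  have oc : (Set.range u).OrdConnected :=
    (isPreconnected_range h.1.continuous).ordConnected
  constructor
  · by_contra hcon
    obtain ⟨y, hy⟩ := (h.2.2.2.eventually (lt_mem_nhds zero_lt_one)).exists
    obtain ⟨x, hx⟩ := oc.out ⟨z, rfl⟩ ⟨y, rfl⟩ ⟨not_lt.1 hcon, hy.le⟩
    exact h.ne_zero hf x hx
  · by_contra hcon
    obtain ⟨y, hy⟩ := (h.2.2.1.eventually (gt_mem_nhds zero_lt_one)).exists
    obtain ⟨x, hx⟩ := oc.out ⟨y, rfl⟩ ⟨z, rfl⟩ ⟨hy.le, not_lt.1 hcon⟩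
    exact h.ne_one hf x hx

theorem IsHeteroclinic.deriv_pos (hf : H1 f) (h : IsHeteroclinic f 1 0 1 u) (z : ℝ) :
    0 < deriv u z := by
  have hne : ∀ x, deriv u x ≠ 0 := fun x hx => by
    have h1 := h.sq_deriv hf x
    rw [hx] at h1
    exact hf.primitive_ne _ (h.mem_Ioo hf x) (by linarith)
  have oc : (Set.range (deriv u)).OrdConnected :=
    (isPreconnected_range (h.1.continuous_deriv one_le_two)).ordConnected
  obtain ⟨a, ha, ha'⟩ := ((h.2.2.1.eventually (gt_mem_nhds (h.mem_Ioo hf 0).1)).and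
    (eventually_lt_atBot 0)).exists
  obtain ⟨ξ, -, hξ⟩ := exists_hasDerivAt_eq_slope u (deriv u) ha'
      h.1.continuous.continuousOn fun x _ => h.hasDerivAt x
  have hpos : 0 < deriv u ξ := by
    rw [hξ]; exact div_pos (by linarith) (by linarith)
  by_contra hcon
  obtain ⟨x, hx⟩ := oc.out ⟨z, rfl⟩ ⟨ξ, rfl⟩ ⟨not_lt.1 hcon, hpos.le⟩
  exact hne x hx

/-- The derivative of a kink is an exponentially localized weight. -/
theorem IsHeteroclinic.exists_isWeight (hf : H1 f) (h : IsHeteroclinic f 1 0 1 u) :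
    ∃ M μ Q, IsWeight (deriv u) (fun z => -f (u z)) M μ Q := by
  have hF := hasDerivAt_primitive hf.contDiff.continuous
  obtain ⟨μ₁, μ₁0, Q₁, Q₁0, h₁⟩ := eventually_nondegenerate (hf.contDiff.of_le one_le_two)
    hF hf.one hf.primitive_one hf.deriv_one
  obtain ⟨μ₀, μ₀0, Q₀, Q₀0, h₀⟩ := eventually_nondegenerate (hf.contDiff.of_le one_le_two)
    hF hf.zero (primitive_zero f) hf.deriv_zero
  have e₁ := h.2.2.2.eventually h₁
  have e₀ := h.2.2.1.eventually h₀
  have pos := h.deriv_pos hf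
  set μ := min μ₀ μ₁
  have μ0 : 0 < μ := lt_min μ₀0 μ₁0
  have r₁ : ∀ᶠ z in atTop, -f (u z) ≤ -μ * deriv u z := by
    filter_upwards [e₁] with z hz
    have hfp := hz.2.2.2.1 (h.mem_Ioo hf z).2
    have h2 := hz.1
    rw [← h.sq_deriv hf, ← mul_pow] at h2
    have h3 := (pow_le_pow_iff_left₀ (mul_nonneg μ₁0.le (pos z).le) hfp.le two_ne_zero).1 h2
    have h4 := mul_le_mul_of_nonneg_right (min_le_right μ₀ μ₁) (pos z).le
    simp only [μ]; linarith
  have r₀ : ∀ᶠ z in atBot, f (u z) ≤ -μ * deriv u z := by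
    filter_upwards [e₀] with z hz
    have hfp := hz.2.2.2.2 (h.mem_Ioo hf z).1
    have h2 := hz.1
    rw [← h.sq_deriv hf, ← mul_pow, ← neg_sq (f (u z))] at h2
    have h3 := (pow_le_pow_iff_left₀ (mul_nonneg μ₀0.le (pos z).le) (by linarith)
      two_ne_zero).1 h2
    have h4 := mul_le_mul_of_nonneg_right (min_le_left μ₀ μ₁) (pos z).le
    simp only [μ]; linarith
  obtain ⟨M₁, M₁0, hM₁⟩ := exists_decay pos h.hasDerivAt_deriv r₁
  obtain ⟨M₀, M₀0, hM₀⟩ := exists_decay (p := fun z => deriv u (-z))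
    (p' := fun z => f (u (-z))) (fun z => pos (-z))
    (fun z => ((h.hasDerivAt_deriv (-z)).comp z (hasDerivAt_neg z)).congr_deriv (by simp))
    (tendsto_neg_atTop_atBot.eventually r₀)
  have hq : ∀ (l : Filter ℝ) (Q : ℝ), 0 < Q →
      (∀ᶠ z in l, f (u z) ^ 2 ≤ Q ^ 2 * (-2 * primitive f (u z))) →
      ∀ᶠ z in l, |f (u z)| / deriv u z ≤ Q := fun l Q Q0 hl => by
    filter_upwards [hl] with z hz
    rw [← h.sq_deriv hf, ← mul_pow] at hz
    rw [div_le_iff₀ (pos z)]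
    exact abs_le_of_sq_le_sq hz (mul_nonneg Q0.le (pos z).le)
  have hfc := hf.contDiff.continuous
  have huc := h.1.continuous
  have hpc := h.1.continuous_deriv one_le_two
  obtain ⟨Q, Q0, hQ⟩ := exists_bound_of_eventually (r := fun z => |f (u z)| / deriv u z)
    (Continuous.div (by fun_prop) hpc fun z => (pos z).ne')
    (hq atBot Q₀ Q₀0 (e₀.mono fun z hz => hz.2.1)) (hq atTop Q₁ Q₁0 (e₁.mono fun z hz => hz.2.1))
  refine ⟨max M₀ M₁, μ, Q, by positivity, μ0, Q0, pos, h.hasDerivAt_deriv, by fun_prop,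
    fun z => ?_, fun z s hz hs => ?_, fun z s hz hs => ?_⟩
  · rw [abs_neg]; exact (div_le_iff₀ (pos z)).1 (hQ z)
  · refine (hM₁ z s hz hs).trans ?_
    have := pos z
    gcongr
    exact le_max_right _ _
  · have := hM₀ (-z) (-s) (by linarith) (by linarith)
    simp only [neg_neg] at this
    refine this.trans ?_
    have := pos z
    rw [show -s - -z = z - s by ring]
    gcongr
    exact le_max_left _ _

end Heteroclinic

/-! ### The linearized equation -/

theorem eLpNorm_two_sq {T : Type*} [MeasurableSpace T] (ν : Measure T) {E : Type*}
    [NormedAddCommGroup E] (y : T → E) :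
    eLpNorm y 2 ν ^ 2 = ∫⁻ z, ‖y z‖ₑ ^ 2 ∂ν := by
  have h := eLpNorm_nnreal_pow_eq_lintegral (f := y) (μ := ν) (p := 2) two_ne_zero
  simpa using h

/-- The Cauchy-Schwarz inequality for functions with values in `[0, ∞]`. -/
theorem sq_lintegral_mul_le {T : Type*} [MeasurableSpace T] (ν : Measure T) {f g : T → ℝ≥0∞}
    (hf : AEMeasurable f ν) (hg : AEMeasurable g ν) :
    (∫⁻ t, f t * g t ∂ν) ^ 2 ≤ (∫⁻ t, f t ^ 2 ∂ν) * ∫⁻ t, g t ^ 2 ∂ν := by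
  have h := ENNReal.lintegral_mul_le_Lp_mul_Lq ν Real.HolderConjugate.two_two hf hg
  refine (pow_le_pow_left' h 2).trans (le_of_eq ?_)
  rw [mul_pow, ← ENNReal.rpow_natCast, ← ENNReal.rpow_natCast, ← ENNReal.rpow_mul,
    ← ENNReal.rpow_mul]
  norm_num

/-- Minkowski's integral inequality in `L²`, for a finite measure and a uniform bound. -/
theorem eLpNorm_two_le_of_lintegral {T : Type*} [MeasurableSpace T] (ν : Measure T)
    [IsFiniteMeasure ν] {H : T → ℝ → ℝ≥0∞} (hH : Measurable (Function.uncurry H)) {N : ℝ≥0∞}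
    (hN : ∀ t, ∫⁻ z, H t z ^ 2 ≤ N ^ 2) {y : ℝ → ℝ} (hy : ∀ z, ‖y z‖ₑ ≤ ∫⁻ t, H t z ∂ν) :
    eLpNorm y 2 ≤ ν Set.univ * N := by
  rw [← ENNReal.pow_le_pow_left_iff two_ne_zero, eLpNorm_two_sq]
  have hm : ∀ z, Measurable fun t => H t z := fun z => hH.comp (measurable_id.prodMk measurable_const)
  calc ∫⁻ z, ‖y z‖ₑ ^ 2 ≤ ∫⁻ z, ν Set.univ * ∫⁻ t, H t z ^ 2 ∂ν := by
        refine lintegral_mono fun z => (pow_le_pow_left' (hy z) 2).trans ?_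
        have h := sq_lintegral_mul_le ν (f := fun _ => 1) aemeasurable_const (hm z).aemeasurable
        simpa using h
    _ = ν Set.univ * ∫⁻ t, (∫⁻ z, H t z ^ 2) ∂ν := by
        rw [lintegral_const_mul' _ _ (measure_ne_top _ _), lintegral_lintegral_swap]
        exact ((hH.comp measurable_swap).pow_const 2).aemeasurable
    _ ≤ ν Set.univ * ∫⁻ _, N ^ 2 ∂ν := by
        gcongr with t
        exact hN t
    _ = (ν Set.univ * N) ^ 2 := by rw [lintegral_const]; ring

theorem integrable_exp_neg_mul_abs {μ : ℝ} (hμ : 0 < μ) :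
    Integrable fun s : ℝ => Real.exp (-μ * |s|) := by
  rw [← integrableOn_univ, ← Set.Iic_union_Ioi (a := (0 : ℝ))]
  refine IntegrableOn.union ?_ ?_
  · refine (integrableOn_exp_mul_Iic hμ 0).congr_fun (fun s hs => ?_) measurableSet_Iic
    simp only [abs_of_nonpos (Set.mem_Iic.1 hs)]; ring_nf
  · refine (integrableOn_exp_mul_Ioi (neg_lt_zero.2 hμ) 0).congr_fun (fun s hs => ?_)
      measurableSet_Ioi
    simp only [abs_of_pos (Set.mem_Ioi.1 hs)]

/-- The convolution of `|h|` with the kernel `M exp (-μ |z|)`. -/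
def expConv (M μ : ℝ) (h : ℝ → ℝ) (z : ℝ) : ℝ≥0∞ :=
  ∫⁻ s, ENNReal.ofReal (M * Real.exp (-μ * |z - s|)) * ‖h s‖ₑ

/-- The total mass of the kernel `M exp (-μ |z|)`. -/
def expMass (M μ : ℝ) : ℝ := ∫ s, M * Real.exp (-μ * |s|)

section ExpKernel

variable {M μ : ℝ} {h y : ℝ → ℝ}

theorem expMass_nonneg (hM : 0 < M) : 0 ≤ expMass M μ :=
  integral_nonneg fun _ => by positivity

theorem lintegral_expKernel (hM : 0 < M) (hμ : 0 < μ) :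
    ∫⁻ s, ENNReal.ofReal (M * Real.exp (-μ * |s|)) = ENNReal.ofReal (expMass M μ) :=
  (ofReal_integral_eq_lintegral_ofReal ((integrable_exp_neg_mul_abs hμ).const_mul M)
    (Eventually.of_forall fun _ => by positivity)).symm

theorem expConv_eq (z : ℝ) : expConv M μ h z =
    ∫⁻ t, ENNReal.ofReal (M * Real.exp (-μ * |t|)) * ‖h (z - t)‖ₑ := by
  rw [expConv, ← lintegral_sub_left_eq_self _ z]
  simp

theorem eLpNorm_le_of_le_expConv (hM : 0 < M) (hμ : 0 < μ) (hh : Continuous h)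
    (hy : ∀ z, ‖y z‖ₑ ≤ expConv M μ h z) :
    eLpNorm y 2 ≤ ENNReal.ofReal (expMass M μ) * eLpNorm h 2 := by
  have hk : Measurable fun s : ℝ => ENNReal.ofReal (M * Real.exp (-μ * |s|)) := by fun_prop
  set ν : Measure ℝ := volume.withDensity fun s => ENNReal.ofReal (M * Real.exp (-μ * |s|))
  have hν : ν Set.univ = ENNReal.ofReal (expMass M μ) := by
    rw [withDensity_apply _ MeasurableSet.univ, setLIntegral_univ, lintegral_expKernel hM hμ]
  have : IsFiniteMeasure ν := ⟨by rw [hν]; exact ENNReal.ofReal_lt_top⟩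
  rw [← hν]
  refine eLpNorm_two_le_of_lintegral ν (H := fun t z => ‖h (z - t)‖ₑ) ?_ (fun t => ?_) fun z => ?_
  · exact (hh.comp (continuous_snd.sub continuous_fst)).measurable.enorm
  · rw [eLpNorm_two_sq, lintegral_sub_right_eq_self fun z => ‖h z‖ₑ ^ 2]
  · refine (hy z).trans (le_of_eq ?_)
    rw [expConv_eq, lintegral_withDensity_eq_lintegral_mul _ hk]
    · rfl
    · exact (hh.comp (continuous_const.sub continuous_id)).measurable.enorm

theorem abs_le_of_le_expConv (hM : 0 < M) (hμ : 0 < μ) {A : ℝ} (hA : ∀ z, |h z| ≤ A)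
    (hy : ∀ z, ‖y z‖ₑ ≤ expConv M μ h z) (z : ℝ) : |y z| ≤ expMass M μ * A := by
  have A0 : 0 ≤ A := (abs_nonneg _).trans (hA 0)
  rw [← ENNReal.ofReal_le_ofReal_iff (mul_nonneg (expMass_nonneg hM) A0), ← Real.enorm_eq_ofReal_abs]
  refine (hy z).trans ?_
  rw [expConv_eq, ENNReal.ofReal_mul (expMass_nonneg hM), ← lintegral_expKernel hM hμ,
    ← lintegral_mul_const _ (by fun_prop)]
  refine lintegral_mono fun t => ?_
  gcongr
  rw [Real.enorm_eq_ofReal_abs]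
  exact ENNReal.ofReal_le_ofReal (hA _)

end ExpKernel

namespace IsWeight

variable {p p' : ℝ → ℝ} {M μ Q : ℝ}

theorem continuous (hp : IsWeight p p' M μ Q) : Continuous p :=
  continuous_iff_continuousAt.2 fun z => (hp.hasDerivAt z).continuousAt

theorem le_exp (hp : IsWeight p p' M μ Q) (s : ℝ) : p s ≤ p 0 * (M * Real.exp (-μ * |s|)) := by
  rw [mul_comm]
  rcases le_total 0 s with h | h
  · simpa [abs_of_nonneg h] using hp.right 0 s le_rfl h
  · simpa [abs_of_nonpos h] using hp.left 0 s le_rfl h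

theorem le_const (hp : IsWeight p p' M μ Q) (s : ℝ) : p s ≤ p 0 * M := by
  refine (hp.le_exp s).trans (mul_le_mul_of_nonneg_left ?_ (hp.pos 0).le)
  refine mul_le_of_le_one_right hp.M_pos.le (Real.exp_le_one_iff.2 ?_)
  have := mul_nonneg hp.rate_pos.le (abs_nonneg s)
  linarith

theorem integrable (hp : IsWeight p p' M μ Q) : Integrable p := by
  refine (((integrable_exp_neg_mul_abs hp.rate_pos).const_mul M).const_mul (p 0)).mono'
    hp.continuous.aestronglyMeasurable (Eventually.of_forall fun s => ?_)
  rw [Real.norm_eq_abs, abs_of_pos (hp.pos s)]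
  exact hp.le_exp s

theorem integrable_mul (hp : IsWeight p p' M μ Q) {h : ℝ → ℝ} (hh : Continuous h) {A : ℝ}
    (hA : ∀ z, |h z| ≤ A) : Integrable fun s => p s * h s :=
  hp.integrable.mul_bdd (c := A) hh.aestronglyMeasurable (Eventually.of_forall hA)

theorem integrable_sq (hp : IsWeight p p' M μ Q) : Integrable fun s => p s * p s :=
  hp.integrable_mul hp.continuous (A := p 0 * M) fun z => by
    rw [abs_of_pos (hp.pos z)]; exact hp.le_const z

theorem memLp (hp : IsWeight p p' M μ Q) : MemLp p 2 := by
  rw [memLp_two_iff_integrable_sq hp.continuous.aestronglyMeasurable]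
  simpa only [sq] using hp.integrable_sq

theorem integral_sq_pos (hp : IsWeight p p' M μ Q) : 0 < ∫ s, p s * p s := by
  rw [integral_pos_iff_support_of_nonneg (fun s => mul_self_nonneg _) hp.integrable_sq]
  have : Function.support (fun s => p s * p s) = Set.univ :=
    Set.eq_univ_of_forall fun s => (mul_pos (hp.pos s) (hp.pos s)).ne'
  simp [this]

end IsWeight

/-- The weighted primitive `∫_{-∞}^z p h`. -/
def cumul (p h : ℝ → ℝ) (z : ℝ) : ℝ := ∫ s in Set.Iic z, p s * h s

/-- The first order unknown of the factorized equation: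
`(d/dz + p'/p) v = h` holds for `v = p⁻¹ ∫_{-∞}^z p h`. -/
def solveFst (p h : ℝ → ℝ) (z : ℝ) : ℝ := cumul p h z / p z

/-- The solution of `w'' - (p''/p) w = h` with `w 0 = 0` obtained from the factorization
`d²/dz² - p''/p = (d/dz + p'/p)(d/dz - p'/p)`. -/
def solve (p h : ℝ → ℝ) (z : ℝ) : ℝ := p z * ∫ s in (0 : ℝ)..z, solveFst p h s / p s

namespace IsWeight

variable {p p' h : ℝ → ℝ} {M μ Q A : ℝ}

theorem hasDerivAt_cumul (hp : IsWeight p p' M μ Q) (hh : Continuous h) (hA : ∀ z, |h z| ≤ A)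
    (z : ℝ) : HasDerivAt (cumul p h) (p z * h z) z := by
  have hc : Continuous fun s => p s * h s := hp.continuous.mul hh
  have hi := hp.integrable_mul hh hA
  have e : cumul p h = fun z => cumul p h 0 + ∫ s in (0 : ℝ)..z, p s * h s := by
    funext z
    rw [← intervalIntegral.integral_Iic_sub_Iic hi.integrableOn hi.integrableOn]
    simp [cumul]
  rw [e]
  exact (hasDerivAt_primitive hc z).const_add _

theorem hasDerivAt_solveFst (hp : IsWeight p p' M μ Q) (hh : Continuous h)
    (hA : ∀ z, |h z| ≤ A) (z : ℝ) :
    HasDerivAt (solveFst p h) (h z - p' z / p z * solveFst p h z) z := by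
  refine ((hp.hasDerivAt_cumul hh hA z).div (hp.hasDerivAt z) (hp.pos z).ne').congr_deriv ?_
  have := (hp.pos z).ne'
  simp only [solveFst]
  field_simp

theorem continuous_solveFst (hp : IsWeight p p' M μ Q) (hh : Continuous h)
    (hA : ∀ z, |h z| ≤ A) : Continuous (solveFst p h) :=
  continuous_iff_continuousAt.2 fun z => (hp.hasDerivAt_solveFst hh hA z).continuousAt

theorem continuous_solveFst_div (hp : IsWeight p p' M μ Q) (hh : Continuous h)
    (hA : ∀ z, |h z| ≤ A) : Continuous fun s => solveFst p h s / p s :=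
  (hp.continuous_solveFst hh hA).div hp.continuous fun z => (hp.pos z).ne'

/-- The first factor of the factorization: `(d/dz - p'/p) w = v`. -/
theorem hasDerivAt_solve (hp : IsWeight p p' M μ Q) (hh : Continuous h)
    (hA : ∀ z, |h z| ≤ A) (z : ℝ) :
    HasDerivAt (solve p h) (p' z / p z * solve p h z + solveFst p h z) z := by
  have hJ := hasDerivAt_primitive (hp.continuous_solveFst_div hh hA) z
  refine ((hp.hasDerivAt z).mul hJ).congr_deriv ?_
  have := (hp.pos z).ne'
  simp only [solve, primitive]
  field_simp

theorem continuous_solve (hp : IsWeight p p' M μ Q) (hh : Continuous h)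
    (hA : ∀ z, |h z| ≤ A) : Continuous (solve p h) :=
  continuous_iff_continuousAt.2 fun z => (hp.hasDerivAt_solve hh hA z).continuousAt

/-- `solve p h` solves the second order equation. -/
theorem hasDerivAt_deriv_solve (hp : IsWeight p p' M μ Q) (hh : Continuous h)
    (hA : ∀ z, |h z| ≤ A) {z c : ℝ} (hp' : HasDerivAt p' (-c * p z) z) :
    HasDerivAt (fun z => p' z / p z * solve p h z + solveFst p h z) (h z - c * solve p h z) z := by
  have hd := ((hp'.div (hp.hasDerivAt z) (hp.pos z).ne').mul (hp.hasDerivAt_solve hh hA z)).add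
    (hp.hasDerivAt_solveFst hh hA z)
  refine hd.congr_deriv ?_
  have := (hp.pos z).ne'
  simp only [Pi.div_apply]
  field_simp
  ring

/-- Below the origin the integral over `(-∞, z]` is used, above the origin the one over `(z, ∞)`,
which is its negative by the solvability condition `∫ p h = 0`. -/
theorem enorm_solveFst_le (hp : IsWeight p p' M μ Q) (hh : Continuous h) (hA : ∀ z, |h z| ≤ A)
    (h0 : ∫ s, p s * h s = 0) (z : ℝ) : ‖solveFst p h z‖ₑ ≤ expConv M μ h z := by
  have hi := hp.integrable_mul hh hA
  have key : ∀ S : Set ℝ, MeasurableSet S →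
      (∀ s ∈ S, p s ≤ M * Real.exp (-μ * |z - s|) * p z) →
      ‖(∫ s in S, p s * h s) / p z‖ₑ ≤ expConv M μ h z := fun S hS hb => by
    rw [← integral_div]
    refine (enorm_integral_le_lintegral_enorm _).trans ?_
    refine le_trans (setLIntegral_mono' hS fun s hs => ?_) (setLIntegral_le_lintegral S _)
    rw [show p s * h s / p z = p s / p z * h s by ring, enorm_mul]
    gcongr
    rw [Real.enorm_of_nonneg (div_pos (hp.pos s) (hp.pos z)).le]
    exact ENNReal.ofReal_le_ofReal ((div_le_iff₀ (hp.pos z)).2 (hb s hs))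
  rcases le_total z 0 with hz | hz
  · refine key _ measurableSet_Iic fun s hs => ?_
    have hs : s ≤ z := hs
    rw [abs_of_nonneg (by linarith)]
    exact hp.left z s hz hs
  · have e : solveFst p h z = -((∫ s in Set.Ioi z, p s * h s) / p z) := by
      have := intervalIntegral.integral_Iic_add_Ioi (b := z) hi.integrableOn hi.integrableOn
      rw [h0] at this
      rw [solveFst, cumul, ← neg_div]
      congr 1
      linarith
    rw [e, enorm_neg]
    refine key _ measurableSet_Ioi fun s hs => ?_
    have hs : z < s := hs
    rw [abs_of_neg (by linarith), neg_sub]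
    exact hp.right z s hz hs.le

/-- The second integration starts at the origin and runs outwards, so that it only meets the ratios
`p z / p s` with `s` between `0` and `z`, which decay. -/
theorem enorm_solve_le (hp : IsWeight p p' M μ Q) (z : ℝ) :
    ‖solve p h z‖ₑ ≤ expConv M μ (solveFst p h) z := by
  have key : ∀ S : Set ℝ, MeasurableSet S →
      (∀ s ∈ S, p z ≤ M * Real.exp (-μ * |z - s|) * p s) →
      ‖p z * ∫ s in S, solveFst p h s / p s‖ₑ ≤ expConv M μ (solveFst p h) z := fun S hS hb => by
    rw [← integral_const_mul]
    refine (enorm_integral_le_lintegral_enorm _).trans ?_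
    refine le_trans (setLIntegral_mono' hS fun s hs => ?_) (setLIntegral_le_lintegral S _)
    rw [show p z * (solveFst p h s / p s) = p z / p s * solveFst p h s by ring, enorm_mul]
    gcongr
    rw [Real.enorm_of_nonneg (div_pos (hp.pos z) (hp.pos s)).le]
    exact ENNReal.ofReal_le_ofReal ((div_le_iff₀ (hp.pos s)).2 (hb s hs))
  rcases le_total z 0 with hz | hz
  · rw [solve, intervalIntegral.integral_of_ge hz, mul_neg, enorm_neg]
    refine key _ measurableSet_Ioc fun s hs => ?_
    rw [abs_of_neg (by linarith [hs.1]), neg_sub]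
    exact hp.left s z hs.2 hs.1.le
  · rw [solve, intervalIntegral.integral_of_le hz]
    refine key _ measurableSet_Ioc fun s hs => ?_
    rw [abs_of_nonneg (by linarith [hs.2])]
    exact hp.right s z hs.1.le hs.2

theorem abs_solve_le (hp : IsWeight p p' M μ Q) (hh : Continuous h) (hA : ∀ z, |h z| ≤ A)
    (h0 : ∫ s, p s * h s = 0) (z : ℝ) : |solve p h z| ≤ expMass M μ ^ 2 * A := by
  refine (abs_le_of_le_expConv hp.M_pos hp.rate_pos (abs_le_of_le_expConv hp.M_pos hp.rate_pos hA
    (hp.enorm_solveFst_le hh hA h0)) hp.enorm_solve_le z).trans (le_of_eq (by ring))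

theorem eLpNorm_solveFst_le (hp : IsWeight p p' M μ Q) (hh : Continuous h) (hA : ∀ z, |h z| ≤ A)
    (h0 : ∫ s, p s * h s = 0) :
    eLpNorm (solveFst p h) 2 ≤ ENNReal.ofReal (expMass M μ) * eLpNorm h 2 :=
  eLpNorm_le_of_le_expConv hp.M_pos hp.rate_pos hh (hp.enorm_solveFst_le hh hA h0)

theorem eLpNorm_solve_le (hp : IsWeight p p' M μ Q) (hh : Continuous h) (hA : ∀ z, |h z| ≤ A)
    (h0 : ∫ s, p s * h s = 0) :
    eLpNorm (solve p h) 2 ≤ ENNReal.ofReal (expMass M μ ^ 2) * eLpNorm h 2 := by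
  refine (eLpNorm_le_of_le_expConv hp.M_pos hp.rate_pos (hp.continuous_solveFst hh hA)
    hp.enorm_solve_le).trans ?_
  rw [sq, ENNReal.ofReal_mul (expMass_nonneg hp.M_pos), mul_assoc]
  gcongr
  exact hp.eLpNorm_solveFst_le hh hA h0

theorem eLpNorm_deriv_solve_le (hp : IsWeight p p' M μ Q) (hh : Continuous h)
    (hA : ∀ z, |h z| ≤ A) (h0 : ∫ s, p s * h s = 0) :
    eLpNorm (fun z => p' z / p z * solve p h z + solveFst p h z) 2 ≤
      ENNReal.ofReal (Q * expMass M μ ^ 2 + expMass M μ) * eLpNorm h 2 := by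
  have hq : Continuous fun z => p' z / p z :=
    hp.continuous_deriv.div hp.continuous fun z => (hp.pos z).ne'
  have hw := hp.continuous_solve hh hA
  refine (eLpNorm_add_le (hq.mul hw).aestronglyMeasurable
    (hp.continuous_solveFst hh hA).aestronglyMeasurable one_le_two).trans ?_
  have m0 := expMass_nonneg (μ := μ) hp.M_pos
  have Q0 := hp.Q_pos
  rw [ENNReal.ofReal_add (by positivity) m0, add_mul, ENNReal.ofReal_mul Q0.le, mul_assoc]
  refine add_le_add ?_ (hp.eLpNorm_solveFst_le hh hA h0)
  refine (eLpNorm_le_mul_eLpNorm_of_ae_le_mul (c := Q) (g := solve p h)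
    (Eventually.of_forall fun z => ?_) 2).trans ?_
  · rw [Pi.mul_apply, norm_mul]
    gcongr
    rw [Real.norm_eq_abs, abs_div, abs_of_pos (hp.pos z), div_le_iff₀ (hp.pos z)]
    exact hp.abs_deriv_le z
  · gcongr
    exact hp.eLpNorm_solve_le hh hA h0

end IsWeight

/-- The component of `g` orthogonal to `p` in `L²(ℝ)`. -/
def proj (p g : ℝ → ℝ) (z : ℝ) : ℝ := g z - (∫ s, p s * g s) / (∫ s, p s * p s) * p z

namespace IsWeight

variable {p p' g g₁ g₂ : ℝ → ℝ} {M μ Q A : ℝ}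

theorem continuous_proj (hp : IsWeight p p' M μ Q) (hg : Continuous g) : Continuous (proj p g) :=
  hg.sub (continuous_const.mul hp.continuous)

theorem abs_integral_mul_le (hp : IsWeight p p' M μ Q) (hA : ∀ z, |g z| ≤ A) :
    |∫ s, p s * g s| ≤ (∫ s, p s) * A := by
  rw [← integral_mul_const]
  refine norm_integral_le_of_norm_le (f := fun s => p s * g s) (hp.integrable.mul_const A)
    (Eventually.of_forall fun s => ?_)
  rw [norm_mul, Real.norm_of_nonneg (hp.pos s).le]
  exact mul_le_mul_of_nonneg_left (hA s) (hp.pos s).le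

theorem exists_abs_proj_le (hp : IsWeight p p' M μ Q) :
    ∃ C ≥ 0, ∀ (g : ℝ → ℝ) (A : ℝ), (∀ z, |g z| ≤ A) → ∀ z, |proj p g z| ≤ C * A := by
  have hP := hp.integral_sq_pos
  have hI : 0 ≤ ∫ s, p s := integral_nonneg fun s => (hp.pos s).le
  have hp0 := hp.pos 0
  have hM := hp.M_pos
  refine ⟨1 + (∫ s, p s) / (∫ s, p s * p s) * (p 0 * M), by positivity, fun g A hA z => ?_⟩
  have A0 : 0 ≤ A := (abs_nonneg _).trans (hA 0)
  have h1 := hp.abs_integral_mul_le hA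
  calc |proj p g z| ≤ |g z| + |(∫ s, p s * g s) / (∫ s, p s * p s) * p z| := abs_sub _ _
    _ ≤ A + (∫ s, p s) * A / (∫ s, p s * p s) * (p 0 * M) := by
        rw [abs_mul, abs_div, abs_of_pos hP, abs_of_pos (hp.pos z)]
        have := hA z
        have := hp.le_const z
        have := (hp.pos z).le
        gcongr
    _ = _ := by ring

theorem exists_eLpNorm_proj_le (hp : IsWeight p p' M μ Q) :
    ∃ C ≥ 0, ∀ g : ℝ → ℝ, Continuous g →
      eLpNorm (proj p g) 2 ≤ ENNReal.ofReal C * eLpNorm g 2 := by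
  have hP := hp.integral_sq_pos
  set P := ∫ s, p s * p s
  have hfin := hp.memLp.eLpNorm_lt_top
  set N := (eLpNorm p 2 volume).toReal with hN
  have hN' : eLpNorm p 2 volume = ENNReal.ofReal N := (ENNReal.ofReal_toReal hfin.ne).symm
  have N0 : 0 ≤ N := ENNReal.toReal_nonneg
  refine ⟨1 + N * P⁻¹ * N, by positivity, fun g hg => ?_⟩
  have hi : ‖∫ s, p s * g s‖ₑ ≤ ENNReal.ofReal N * eLpNorm g 2 := by
    refine (enorm_integral_le_lintegral_enorm _).trans ?_
    rw [← ENNReal.pow_le_pow_left_iff two_ne_zero, mul_pow, ← hN', eLpNorm_two_sq, eLpNorm_two_sq]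
    simp only [enorm_mul]
    exact sq_lintegral_mul_le _ hp.continuous.enorm.measurable.aemeasurable
      hg.enorm.measurable.aemeasurable
  refine (eLpNorm_sub_le hg.aestronglyMeasurable
    (continuous_const.mul hp.continuous).aestronglyMeasurable one_le_two).trans ?_
  rw [ENNReal.ofReal_add zero_le_one (by positivity), add_mul, ENNReal.ofReal_one, one_mul]
  gcongr
  change eLpNorm (((∫ s, p s * g s) / P) • p) 2 volume ≤ _
  rw [eLpNorm_const_smul, hN', div_eq_mul_inv, enorm_mul, Real.enorm_of_nonneg (inv_pos.2 hP).le,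
    ENNReal.ofReal_mul (by positivity), ENNReal.ofReal_mul N0]
  calc _ ≤ ENNReal.ofReal N * eLpNorm g 2 volume * ENNReal.ofReal P⁻¹ * ENNReal.ofReal N := by
        gcongr
    _ = _ := by ring

theorem integral_mul_proj (hp : IsWeight p p' M μ Q) (hg : Continuous g) (hA : ∀ z, |g z| ≤ A) :
    ∫ s, p s * proj p g s = 0 := by
  have e : (fun s => p s * proj p g s) =
      fun s => p s * g s - (∫ s, p s * g s) / (∫ s, p s * p s) * (p s * p s) := by
    funext s; simp only [proj]; ring
  rw [e, integral_sub (hp.integrable_mul hg hA) (hp.integrable_sq.const_mul _),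
    integral_const_mul, div_mul_cancel₀ _ hp.integral_sq_pos.ne', sub_self]

theorem proj_sub (hp : IsWeight p p' M μ Q) (hg₁ : Continuous g₁) (hA₁ : ∀ z, |g₁ z| ≤ A)
    (hg₂ : Continuous g₂) (hA₂ : ∀ z, |g₂ z| ≤ A) (z : ℝ) :
    proj p (fun z => g₁ z - g₂ z) z = proj p g₁ z - proj p g₂ z := by
  simp only [proj, mul_sub]
  rw [integral_sub (hp.integrable_mul hg₁ hA₁) (hp.integrable_mul hg₂ hA₂)]
  ring

theorem solve_sub (hp : IsWeight p p' M μ Q) (hg₁ : Continuous g₁) (hA₁ : ∀ z, |g₁ z| ≤ A)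
    (hg₂ : Continuous g₂) (hA₂ : ∀ z, |g₂ z| ≤ A) (z : ℝ) :
    solve p (fun z => g₁ z - g₂ z) z = solve p g₁ z - solve p g₂ z := by
  have e : ∀ s, solveFst p (fun z => g₁ z - g₂ z) s = solveFst p g₁ s - solveFst p g₂ s :=
    fun s => by
      simp only [solveFst, cumul, mul_sub]
      rw [integral_sub (hp.integrable_mul hg₁ hA₁).integrableOn
        (hp.integrable_mul hg₂ hA₂).integrableOn, sub_div]
  simp only [solve, e, sub_div]
  rw [intervalIntegral.integral_sub
    ((hp.continuous_solveFst_div hg₁ hA₁).intervalIntegrable _ _)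
    ((hp.continuous_solveFst_div hg₂ hA₂).intervalIntegrable _ _), mul_sub]

end IsWeight

/-! ### The coupling, the remainder and the contraction principle -/

/-- The nonlocal coupling `∑ₖ aₖ u(z - k)`. -/
def coupling (a : ℤ → ℝ) (u : ℝ → ℝ) (z : ℝ) : ℝ := ∑' k : ℤ, a k * u (z - k)

/-- Minkowski's inequality in `L²` for weighted sums over `ℤ`. -/
theorem eLpNorm_two_le_of_tsum {c : ℤ → ℝ} (hc : Summable c) (c0 : ∀ k, 0 ≤ c k)
    {H : ℤ → ℝ → ℝ≥0∞} (hH : ∀ k, Measurable (H k)) {N : ℝ≥0∞}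
    (hN : ∀ k, ∫⁻ z, H k z ^ 2 ≤ N ^ 2) {y : ℝ → ℝ}
    (hy : ∀ z, ‖y z‖ₑ ≤ ∑' k, ENNReal.ofReal (c k) * H k z) :
    eLpNorm y 2 ≤ ENNReal.ofReal (∑' k, c k) * N := by
  set ν : Measure ℤ := Measure.count.withDensity fun k => ENNReal.ofReal (c k) with hνdef
  have hν : ν Set.univ = ENNReal.ofReal (∑' k, c k) := by
    rw [hνdef, withDensity_apply _ MeasurableSet.univ, setLIntegral_univ, lintegral_count,
      ENNReal.ofReal_tsum_of_nonneg c0 hc]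
  have : IsFiniteMeasure ν := ⟨by rw [hν]; exact ENNReal.ofReal_lt_top⟩
  rw [← hν]
  refine eLpNorm_two_le_of_lintegral ν (measurable_from_prod_countable_right hH) hN fun z =>
    (hy z).trans (le_of_eq ?_)
  rw [hνdef, lintegral_withDensity_eq_lintegral_mul _ (measurable_of_countable _)
    (measurable_of_countable _), lintegral_count]
  rfl

/-- The mean value inequality in `L²` for a translation. -/
theorem eLpNorm_translate_sub_le {u u' : ℝ → ℝ} (hu : ∀ z, HasDerivAt u (u' z) z)
    (hc : Continuous u') (c : ℝ) :
    eLpNorm (fun z => u (z + c) - u z) 2 ≤ ‖c‖ₑ * eLpNorm u' 2 := by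
  set ν : Measure ℝ := volume.restrict (Set.Ioc 0 1)
  have hν : ν Set.univ = 1 := by simp [ν]
  have h := eLpNorm_two_le_of_lintegral ν (H := fun t z => ‖c * u' (z + c * t)‖ₑ)
    (N := ‖c‖ₑ * eLpNorm u' 2) (y := fun z => u (z + c) - u z) ?_ (fun t => ?_) fun z => ?_
  · rwa [hν, one_mul] at h
  · refine Continuous.measurable ?_
    unfold Function.uncurry
    fun_prop
  · simp only [enorm_mul, mul_pow]
    rw [lintegral_const_mul' _ _ (by simp),
      lintegral_add_right_eq_self (fun z => ‖u' z‖ₑ ^ 2), eLpNorm_two_sq]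
  · have e : ∫ t in (0 : ℝ)..1, c * u' (z + c * t) = u (z + c) - u z := by
      rw [intervalIntegral.integral_eq_sub_of_hasDerivAt (f := fun t => u (z + c * t))]
      · simp
      · intro t _
        have h1 : HasDerivAt (fun t : ℝ => z + c * t) c t := by
          simpa using ((hasDerivAt_id' t).const_mul c).const_add z
        exact ((hu (z + c * t)).comp t h1).congr_deriv (mul_comm _ _)
      · exact Continuous.intervalIntegrable (by fun_prop) _ _
    rw [← e, intervalIntegral.integral_of_le zero_le_one]
    exact enorm_integral_le_lintegral_enorm _

namespace H2

variable {a : ℤ → ℝ} {u u' u₁ u₂ : ℝ → ℝ} {A : ℝ}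

theorem summable_abs (ha : H2 a) : Summable fun k => |a k| := ha.sum_eq_zero.summable.abs

theorem summable_moment (ha : H2 a) : Summable fun k : ℤ => |a k| * |(k : ℝ)| := by
  have h : Summable fun n : ℕ => |a (n : ℤ)| * |((n : ℤ) : ℝ)| := by
    refine Summable.of_nonneg_of_le (fun n => by positivity) (fun n => ?_) ha.summable
    refine mul_le_mul_of_nonneg_left ?_ (abs_nonneg _)
    rw [Int.cast_natCast, Nat.abs_cast]
    exact_mod_cast Nat.le_self_pow two_ne_zero n
  refine Summable.of_nat_of_neg h ?_
  refine h.congr fun n => ?_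
  rw [← ha.symm (n : ℤ)]
  simp

theorem summable_mul (ha : H2 a) (hA : ∀ z, |u z| ≤ A) (z : ℝ) :
    Summable fun k : ℤ => a k * u (z - k) := by
  refine Summable.of_norm_bounded (ha.summable_abs.mul_right A) fun k => ?_
  rw [norm_mul]
  exact mul_le_mul_of_nonneg_left (hA _) (abs_nonneg _)

theorem continuous_coupling (ha : H2 a) (hu : Continuous u) (hA : ∀ z, |u z| ≤ A) :
    Continuous (coupling a u) := by
  refine continuous_tsum (fun k => by fun_prop) (ha.summable_abs.mul_right A) fun k z => ?_
  rw [norm_mul]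
  exact mul_le_mul_of_nonneg_left (hA _) (abs_nonneg _)

theorem abs_coupling_le (ha : H2 a) (hA : ∀ z, |u z| ≤ A) (z : ℝ) :
    |coupling a u z| ≤ (∑' k, |a k|) * A := by
  rw [← tsum_mul_right]
  change ‖∑' k : ℤ, a k * u (z - k)‖ ≤ _
  refine tsum_of_norm_bounded (ha.summable_abs.mul_right A).hasSum fun k => ?_
  rw [norm_mul]
  exact mul_le_mul_of_nonneg_left (hA _) (abs_nonneg _)

theorem coupling_add (ha : H2 a) {A₁ A₂ : ℝ} (h₁ : ∀ z, |u₁ z| ≤ A₁) (h₂ : ∀ z, |u₂ z| ≤ A₂)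
    (z : ℝ) : coupling a (fun z => u₁ z + u₂ z) z = coupling a u₁ z + coupling a u₂ z := by
  simp only [coupling, mul_add]
  exact (ha.summable_mul h₁ z).tsum_add (ha.summable_mul h₂ z)

theorem coupling_sub (ha : H2 a) {A₁ A₂ : ℝ} (h₁ : ∀ z, |u₁ z| ≤ A₁) (h₂ : ∀ z, |u₂ z| ≤ A₂)
    (z : ℝ) : coupling a (fun z => u₁ z - u₂ z) z = coupling a u₁ z - coupling a u₂ z := by
  simp only [coupling, mul_sub]
  exact (ha.summable_mul h₁ z).tsum_sub (ha.summable_mul h₂ z)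

theorem eLpNorm_coupling_le (ha : H2 a) (hu : Continuous u) :
    eLpNorm (coupling a u) 2 ≤ ENNReal.ofReal (∑' k, |a k|) * eLpNorm u 2 := by
  refine eLpNorm_two_le_of_tsum ha.summable_abs (fun _ => abs_nonneg _)
    (H := fun k z => ‖u (z - k)‖ₑ) (fun k => ?_) (fun k => ?_) fun z => ?_
  · exact (hu.comp (continuous_id.sub continuous_const)).enorm.measurable
  · rw [lintegral_sub_right_eq_self (fun z => ‖u z‖ₑ ^ 2), eLpNorm_two_sq]
  · refine (enorm_tsum_le_tsum_enorm).trans (le_of_eq ?_)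
    simp only [enorm_mul, Real.enorm_eq_ofReal_abs (a _)]

/-- Since the coefficients sum to zero, `u` may be replaced by the increments `u(z - k) - u(z)`. -/
theorem hasSum_increment (ha : H2 a) (hA : ∀ z, |u z| ≤ A) (z : ℝ) :
    HasSum (fun k : ℤ => a k * (u (z - k) - u z)) (coupling a u z) := by
  have h := (ha.summable_mul hA z).hasSum.sub (ha.sum_eq_zero.mul_right (u z))
  simpa [mul_sub, coupling] using h

/-- Unlike `H2.eLpNorm_coupling_le` this bound applies to a kink, which is not in `L²(ℝ)`. -/
theorem eLpNorm_coupling_le_deriv (ha : H2 a) (hu : ∀ z, HasDerivAt u (u' z) z)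
    (hc : Continuous u') (hA : ∀ z, |u z| ≤ A) :
    eLpNorm (coupling a u) 2 ≤ ENNReal.ofReal (∑' k : ℤ, |a k| * |(k : ℝ)|) * eLpNorm u' 2 := by
  have huc : Continuous u := continuous_iff_continuousAt.2 fun z => (hu z).continuousAt
  refine eLpNorm_two_le_of_tsum ha.summable_moment (fun _ => by positivity)
    (H := fun k z => ‖(k : ℝ)⁻¹ * (u (z - k) - u z)‖ₑ) (fun k => ?_) (fun k => ?_) fun z => ?_
  · exact (Continuous.enorm (by fun_prop)).measurable
  · rw [← eLpNorm_two_sq]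
    refine pow_le_pow_left' ?_ 2
    change eLpNorm ((k : ℝ)⁻¹ • fun z => u (z - k) - u z) 2 volume ≤ _
    rw [eLpNorm_const_smul]
    have h := eLpNorm_translate_sub_le hu hc (-(k : ℝ))
    simp only [← sub_eq_add_neg, enorm_neg] at h
    refine (mul_le_mul_right h _).trans ?_
    rw [← mul_assoc, ← enorm_mul]
    rcases eq_or_ne (k : ℝ) 0 with hk | hk
    · simp [hk]
    · rw [inv_mul_cancel₀ hk]; simp
  · rw [← (ha.hasSum_increment hA z).tsum_eq]
    refine enorm_tsum_le_tsum_enorm.trans (le_of_eq (tsum_congr fun k => ?_))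
    rw [← abs_mul, ← Real.enorm_eq_ofReal_abs, ← enorm_mul, mul_assoc]
    rcases eq_or_ne (k : ℝ) 0 with hk | hk
    · simp [hk]
    · rw [mul_inv_cancel_left₀ hk]

end H2

/-- The quadratic remainder of `f` at `x`. -/
def remainder (f : ℝ → ℝ) (x t : ℝ) : ℝ := f (x + t) - f x - deriv f x * t

/-- The remainder is Lipschitz on `[-A, A]`, with a constant proportional to `A`. -/
theorem exists_remainder_le {f : ℝ → ℝ} (hf : ContDiff ℝ 2 f) :
    ∃ K ≥ 0, ∀ x ∈ Set.Icc (0 : ℝ) 1, ∀ A ≤ 1, ∀ s t, |s| ≤ A → |t| ≤ A →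
      |remainder f x s - remainder f x t| ≤ K * A * |s - t| := by
  have hf' : ContDiff ℝ 1 (deriv f) := hf.deriv' (n := 1)
  obtain ⟨K, hK⟩ := isCompact_Icc.exists_bound_of_continuousOn
    (hf'.continuous_deriv le_rfl).continuousOn (s := Set.Icc (-1 : ℝ) 2)
  have K0 : 0 ≤ K := (norm_nonneg _).trans (hK 0 ⟨by norm_num, by norm_num⟩)
  refine ⟨K, K0, fun x hx A A1 s t hs ht => ?_⟩
  have hd : ∀ r, HasDerivAt (remainder f x) (deriv f (x + r) - deriv f x) r := fun r => by
    have h1 : HasDerivAt (fun r => x + r) 1 r := (hasDerivAt_id' r).const_add x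
    have h2 := ((hf.differentiable two_ne_zero (x + r)).hasDerivAt.comp r h1)
    have h3 := (h2.sub_const (f x)).sub ((hasDerivAt_id' r).const_mul (deriv f x))
    exact h3.congr_deriv (by ring)
  refine (convex_Icc (-A) A).norm_image_sub_le_of_norm_hasDerivWithin_le
    (fun r _ => (hd r).hasDerivWithinAt) (fun r hr => ?_) (abs_le.1 ht) (abs_le.1 hs)
  have hmem : ∀ y ∈ Set.Icc (-A) A, x + y ∈ Set.Icc (-1 : ℝ) 2 := fun y hy =>
    ⟨by linarith [hx.1, hy.1], by linarith [hx.2, hy.2]⟩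
  have h := (convex_Icc (-1 : ℝ) 2).norm_image_sub_le_of_norm_deriv_le (f := deriv f)
    (fun y _ => hf'.differentiable one_ne_zero y) hK
    (x := x) (y := x + r) ⟨by linarith [hx.1], by linarith [hx.2]⟩ (hmem r hr)
  refine h.trans (mul_le_mul_of_nonneg_left ?_ K0)
  simpa [abs_le] using hr

/-- The contraction principle in the uniform metric, on functions bounded by `A` uniformly and in
`L²(ℝ)`. The set of these functions is closed by Fatou's lemma, so that the map needs to be
Lipschitz in the uniform metric only. -/
theorem exists_fixedPoint_of_contraction {Φ : (ℝ → ℝ) → ℝ → ℝ} {A : ℝ} (A0 : 0 ≤ A)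
    (hmap : ∀ w, Continuous w → (∀ z, |w z| ≤ A) → eLpNorm w 2 ≤ ENNReal.ofReal A →
      Continuous (Φ w) ∧ (∀ z, |Φ w z| ≤ A) ∧ eLpNorm (Φ w) 2 ≤ ENNReal.ofReal A)
    (hcon : ∀ w₁ w₂, Continuous w₁ → Continuous w₂ → (∀ z, |w₁ z| ≤ A) → (∀ z, |w₂ z| ≤ A) →
      ∀ δ, (∀ z, |w₁ z - w₂ z| ≤ δ) → ∀ z, |Φ w₁ z - Φ w₂ z| ≤ δ / 2) :
    ∃ w, Continuous w ∧ (∀ z, |w z| ≤ A) ∧ eLpNorm w 2 ≤ ENNReal.ofReal A ∧ Φ w = w := by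
  let S : Set (BoundedContinuousFunction ℝ ℝ) :=
    {w | (∀ z, |w z| ≤ A) ∧ eLpNorm w 2 ≤ ENNReal.ofReal A}
  have hS : IsClosed S := by
    refine IsSeqClosed.isClosed fun w w' hw hlim => ?_
    have hpt : ∀ z, Tendsto (fun n => w n z) atTop (𝓝 (w' z)) := fun z =>
      (BoundedContinuousFunction.tendsto_iff_tendstoUniformly.1 hlim).tendsto_at z
    refine ⟨fun z => le_of_tendsto (hpt z).abs (Eventually.of_forall fun n => (hw n).1 z), ?_⟩
    exact Lp.eLpNorm_le_of_ae_tendsto (Eventually.of_forall fun n => (hw n).2)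
      (fun n => (w n).continuous.aestronglyMeasurable) (Eventually.of_forall hpt)
  have : CompleteSpace S := hS.completeSpace_coe
  have : Nonempty S := ⟨⟨0, by simp [A0], by simp⟩⟩
  let F : S → S := fun w =>
    have h := hmap w.1 w.1.continuous w.2.1 w.2.2
    ⟨BoundedContinuousFunction.ofNormedAddCommGroup (Φ w.1) h.1 A h.2.1, h.2⟩
  have hF : ContractingWith (1 / 2) F := by
    refine ⟨by norm_num, LipschitzWith.of_dist_le_mul fun w₁ w₂ => ?_⟩
    rw [Subtype.dist_eq, BoundedContinuousFunction.dist_le (by positivity)]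
    intro z
    have h := hcon w₁.1 w₂.1 w₁.1.continuous w₂.1.continuous w₁.2.1 w₂.2.1 (dist w₁ w₂)
      (fun z => BoundedContinuousFunction.dist_coe_le_dist (f := w₁.1) (g := w₂.1) z) z
    refine le_trans h (le_of_eq ?_)
    push_cast
    ring
  refine ⟨(hF.fixedPoint F).1, (hF.fixedPoint F).1.continuous, (hF.fixedPoint F).2.1,
    (hF.fixedPoint F).2.2, ?_⟩
  have h := congrArg (fun w : S => (w.1 : ℝ → ℝ)) hF.fixedPoint_isFixedPt
  exact h

/-! ### The projected equation -/

/-- The bounded right inverse of `d²/dz² - p''/p` on the complement of `p`. -/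
def resolvent (p g : ℝ → ℝ) : ℝ → ℝ := solve p (proj p g)

/-- The derivative of `resolvent p g`. -/
def resolventDeriv (p p' g : ℝ → ℝ) (z : ℝ) : ℝ :=
  p' z / p z * resolvent p g z + solveFst p (proj p g) z

theorem IsWeight.exists_resolvent_bounds {p p' : ℝ → ℝ} {M μ Q : ℝ} (hp : IsWeight p p' M μ Q) :
    ∃ C > 0, ∀ g : ℝ → ℝ, Continuous g → ∀ A, (∀ z, |g z| ≤ A) →
      (∀ z, |resolvent p g z| ≤ C * A) ∧ (∀ z, |resolventDeriv p p' g z| ≤ C * A) ∧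
      eLpNorm (proj p g) 2 ≤ ENNReal.ofReal C * eLpNorm g 2 ∧
      eLpNorm (resolvent p g) 2 ≤ ENNReal.ofReal C * eLpNorm g 2 ∧
      eLpNorm (resolventDeriv p p' g) 2 ≤ ENNReal.ofReal C * eLpNorm g 2 := by
  obtain ⟨C₁, C₁0, h₁⟩ := hp.exists_abs_proj_le
  obtain ⟨C₂, C₂0, h₂⟩ := hp.exists_eLpNorm_proj_le
  have m0 := expMass_nonneg (μ := μ) hp.M_pos
  have Q0 := hp.Q_pos
  set m := expMass M μ
  set C₃ := 1 + m ^ 2 + (Q * m ^ 2 + m)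
  have hC₃ : 0 < C₃ := by positivity
  have a1 : m ^ 2 ≤ C₃ := by
    have : 0 ≤ Q * m ^ 2 + m := by positivity
    linarith
  have a2 : Q * m ^ 2 + m ≤ C₃ := by linarith [sq_nonneg m]
  have a3 : 1 ≤ C₃ := by
    have : 0 ≤ m ^ 2 + (Q * m ^ 2 + m) := by positivity
    linarith
  set C := C₃ * (1 + C₁ + C₂)
  refine ⟨C, by positivity, fun g hg A hA => ?_⟩
  have A0 : 0 ≤ A := (abs_nonneg _).trans (hA 0)
  have hc := hp.continuous_proj hg
  have hb := h₁ g A hA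
  have h0 := hp.integral_mul_proj hg hA
  have B0 : 0 ≤ C₁ * A := by positivity
  have fin : C₃ * (C₁ * A) ≤ C * A := by
    rw [← mul_assoc]
    gcongr
    exact mul_le_mul_of_nonneg_left (by linarith) hC₃.le
  have fin2 : ∀ {c : ℝ}, c ≤ C₃ →
      ENNReal.ofReal c * eLpNorm (proj p g) 2 ≤ ENNReal.ofReal C * eLpNorm g 2 := fun hcC => by
    calc _ ≤ ENNReal.ofReal C₃ * (ENNReal.ofReal C₂ * eLpNorm g 2) := by
          gcongr
          exact h₂ g hg
      _ = ENNReal.ofReal (C₃ * C₂) * eLpNorm g 2 := by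
          rw [ENNReal.ofReal_mul hC₃.le, mul_assoc]
      _ ≤ _ := by
          gcongr
          exact mul_le_mul_of_nonneg_left (by linarith) hC₃.le
  have hw : ∀ z, |resolvent p g z| ≤ m ^ 2 * (C₁ * A) := hp.abs_solve_le hc hb h0
  refine ⟨fun z => (hw z).trans (le_trans (by gcongr) fin), fun z => ?_, ?_,
    (hp.eLpNorm_solve_le hc hb h0).trans (fin2 a1),
    (hp.eLpNorm_deriv_solve_le hc hb h0).trans (fin2 a2)⟩
  · have hv : |solveFst p (proj p g) z| ≤ m * (C₁ * A) :=
      abs_le_of_le_expConv hp.M_pos hp.rate_pos hb (hp.enorm_solveFst_le hc hb h0) z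
    have hq : |p' z / p z| ≤ Q := by
      rw [abs_div, abs_of_pos (hp.pos z), div_le_iff₀ (hp.pos z)]
      exact hp.abs_deriv_le z
    calc |resolventDeriv p p' g z| ≤ |p' z / p z| * |resolvent p g z| +
          |solveFst p (proj p g) z| := (abs_add_le _ _).trans_eq (by rw [abs_mul])
      _ ≤ Q * (m ^ 2 * (C₁ * A)) + m * (C₁ * A) := by
          have := hw z
          gcongr
      _ = (Q * m ^ 2 + m) * (C₁ * A) := by ring
      _ ≤ _ := le_trans (by gcongr) fin
  · have := fin2 a3
    rwa [ENNReal.ofReal_one, one_mul] at this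

theorem IsWeight.resolvent_sub {p p' g₁ g₂ : ℝ → ℝ} {M μ Q A : ℝ} (hp : IsWeight p p' M μ Q)
    (hg₁ : Continuous g₁) (hA₁ : ∀ z, |g₁ z| ≤ A) (hg₂ : Continuous g₂) (hA₂ : ∀ z, |g₂ z| ≤ A)
    (z : ℝ) : resolvent p (fun z => g₁ z - g₂ z) z = resolvent p g₁ z - resolvent p g₂ z := by
  obtain ⟨C, -, hC⟩ := hp.exists_abs_proj_le
  rw [resolvent, show proj p (fun z => g₁ z - g₂ z) = fun z => proj p g₁ z - proj p g₂ z from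
    funext fun z => hp.proj_sub hg₁ hA₁ hg₂ hA₂ z]
  exact hp.solve_sub (hp.continuous_proj hg₁) (hC g₁ A hA₁) (hp.continuous_proj hg₂)
    (hC g₂ A hA₂) z

/-- The right-hand side of the equation `w'' + f'(u) w = force` for the correction `w` of `u`. -/
def force (a : ℤ → ℝ) (f : ℝ → ℝ) (ε : ℝ) (u w : ℝ → ℝ) (z : ℝ) : ℝ :=
  ε * coupling a u z + ε * coupling a w z - remainder f (u z) (w z)

theorem remainder_zero (f : ℝ → ℝ) (x : ℝ) : remainder f x 0 = 0 := by simp [remainder]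

section

variable {a : ℤ → ℝ} {f u : ℝ → ℝ}

theorem IsHeteroclinic.abs_le_one (hf : H1 f) (hu : IsHeteroclinic f 1 0 1 u) (z : ℝ) :
    |u z| ≤ 1 := by
  have := hu.mem_Ioo hf z
  rw [abs_of_pos this.1]; exact this.2.le

theorem continuous_force (hf : H1 f) (ha : H2 a) (hu : IsHeteroclinic f 1 0 1 u) (ε : ℝ)
    {w : ℝ → ℝ} (hw : Continuous w) {A : ℝ} (hA : ∀ z, |w z| ≤ A) :
    Continuous (force a f ε u w) := by
  have h1 := ha.continuous_coupling hu.1.continuous (hu.abs_le_one hf)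
  have h2 := ha.continuous_coupling hw hA
  have h3 := hf.contDiff.continuous
  have h4 := hf.contDiff.continuous_deriv one_le_two
  have h5 := hu.1.continuous
  unfold force remainder
  fun_prop

/-- Bounds for the force on functions bounded by `A`, of order `ε` for the kink itself and with the
small Lipschitz constant `(ε + A) L`. -/
theorem exists_force_bounds (hf : H1 f) (ha : H2 a) (hu : IsHeteroclinic f 1 0 1 u) :
    ∃ B > 0, ∃ L ≥ 0, ∀ ε ≥ 0, ∀ A ≤ 1,
      (∀ w : ℝ → ℝ, Continuous w → (∀ z, |w z| ≤ A) →
        (∀ z, |force a f ε u w z| ≤ ε * B + (ε + A) * L * A) ∧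
        (eLpNorm w 2 ≤ ENNReal.ofReal A →
          eLpNorm (force a f ε u w) 2 ≤ ENNReal.ofReal (ε * B + (ε + A) * L * A))) ∧
      ∀ w₁ w₂ : ℝ → ℝ, (∀ z, |w₁ z| ≤ A) → (∀ z, |w₂ z| ≤ A) → ∀ δ, (∀ z, |w₁ z - w₂ z| ≤ δ) →
        ∀ z, |force a f ε u w₁ z - force a f ε u w₂ z| ≤ (ε + A) * L * δ := by
  obtain ⟨K, K0, hK⟩ := exists_remainder_le hf.contDiff
  obtain ⟨M, μ, Q, hp⟩ := hu.exists_isWeight hf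
  set α := ∑' k, |a k|
  have α0 : 0 ≤ α := tsum_nonneg fun k => abs_nonneg _
  set β := ∑' k : ℤ, |a k| * |(k : ℝ)|
  have β0 : 0 ≤ β := tsum_nonneg fun k => by positivity
  set N := (eLpNorm (deriv u) 2 volume).toReal
  have hN : eLpNorm (deriv u) 2 volume = ENNReal.ofReal N :=
    (ENNReal.ofReal_toReal hp.memLp.eLpNorm_lt_top.ne).symm
  have N0 : 0 ≤ N := ENNReal.toReal_nonneg
  have hu1 := hu.abs_le_one hf
  have huc := hu.1.continuous
  have hx : ∀ z, u z ∈ Set.Icc (0 : ℝ) 1 := fun z => Set.Ioo_subset_Icc_self (hu.mem_Ioo hf z)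
  refine ⟨1 + α + β * N, by positivity, α + K, by positivity, fun ε ε0 A A1 => ⟨fun w hw hA => ?_,
    fun w₁ w₂ hA₁ hA₂ δ hδ z => ?_⟩⟩
  · have A0 : 0 ≤ A := (abs_nonneg _).trans (hA 0)
    have hr : ∀ z, |remainder f (u z) (w z)| ≤ K * A * |w z| := fun z => by
      have := hK (u z) (hx z) A A1 (w z) 0 (hA z) (by simpa using A0)
      simpa [remainder_zero] using this
    have hsum : ε * α + ε * (α * A) + K * A * A ≤ ε * (1 + α + β * N) + (ε + A) * (α + K) * A := by
      have : 0 ≤ ε * 1 + ε * (β * N) + ε * K * A + A * α * A := by positivity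
      nlinarith
    refine ⟨fun z => ?_, fun h2 => ?_⟩
    · have h1 := ha.abs_coupling_le hu1 z
      have h2 := ha.abs_coupling_le hA z
      calc |force a f ε u w z| ≤ |ε * coupling a u z| + |ε * coupling a w z| +
            |remainder f (u z) (w z)| := (abs_sub _ _).trans (by gcongr; exact abs_add_le _ _)
        _ ≤ ε * (α * 1) + ε * (α * A) + K * A * A := by
            rw [abs_mul, abs_mul, abs_of_nonneg ε0]
            have := hr z
            have := hA z
            gcongr
            exact (hr z).trans (by gcongr)
        _ ≤ _ := by rw [mul_one]; exact hsum
    · have c1 := ha.continuous_coupling huc hu1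
      have c2 := ha.continuous_coupling hw hA
      have cr : Continuous fun z => remainder f (u z) (w z) := by
        have h3 := hf.contDiff.continuous
        have h4 := hf.contDiff.continuous_deriv one_le_two
        unfold remainder
        fun_prop
      have e1 : eLpNorm (ε • coupling a u) 2 ≤ ENNReal.ofReal (ε * (β * N)) := by
        rw [eLpNorm_const_smul, Real.enorm_of_nonneg ε0, ENNReal.ofReal_mul ε0,
          ENNReal.ofReal_mul β0, ← hN]
        gcongr
        exact ha.eLpNorm_coupling_le_deriv hu.hasDerivAt (hu.1.continuous_deriv one_le_two) hu1
      have e2 : eLpNorm (ε • coupling a w) 2 ≤ ENNReal.ofReal (ε * (α * A)) := by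
        rw [eLpNorm_const_smul, Real.enorm_of_nonneg ε0, ENNReal.ofReal_mul ε0,
          ENNReal.ofReal_mul α0]
        gcongr
        exact (ha.eLpNorm_coupling_le hw).trans (by gcongr)
      have e3 : eLpNorm (fun z => remainder f (u z) (w z)) 2 ≤ ENNReal.ofReal (K * A * A) := by
        refine (eLpNorm_le_mul_eLpNorm_of_ae_le_mul (g := w) (Eventually.of_forall hr) 2).trans ?_
        rw [ENNReal.ofReal_mul (by positivity : 0 ≤ K * A)]
        gcongr
      have s1 : AEStronglyMeasurable (ε • coupling a u) volume :=
        (c1.const_smul ε).aestronglyMeasurable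
      have s2 : AEStronglyMeasurable (ε • coupling a w) volume :=
        (c2.const_smul ε).aestronglyMeasurable
      refine (eLpNorm_sub_le (s1.add s2) cr.aestronglyMeasurable one_le_two).trans ?_
      refine (add_le_add ((eLpNorm_add_le s1 s2 one_le_two).trans (add_le_add e1 e2)) e3).trans ?_
      rw [← ENNReal.ofReal_add (by positivity) (by positivity),
        ← ENNReal.ofReal_add (by positivity) (by positivity)]
      refine ENNReal.ofReal_le_ofReal ?_
      have : 0 ≤ ε * 1 + ε * α + ε * K * A + A * α * A := by positivity
      nlinarith
  · have A0 : 0 ≤ A := (abs_nonneg _).trans (hA₁ 0)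
    have δ0 : 0 ≤ δ := (abs_nonneg _).trans (hδ 0)
    have h1 := ha.abs_coupling_le hδ z
    rw [ha.coupling_sub hA₁ hA₂] at h1
    have h2 := hK (u z) (hx z) A A1 _ _ (hA₁ z) (hA₂ z)
    have h3 := hδ z
    have e : force a f ε u w₁ z - force a f ε u w₂ z = ε * (coupling a w₁ z - coupling a w₂ z) -
        (remainder f (u z) (w₁ z) - remainder f (u z) (w₂ z)) := by
      simp only [force]; ring
    rw [e]
    calc _ ≤ |ε * (coupling a w₁ z - coupling a w₂ z)| +
          |remainder f (u z) (w₁ z) - remainder f (u z) (w₂ z)| := abs_sub _ _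
      _ ≤ ε * (α * δ) + K * A * δ := by
          rw [abs_mul, abs_of_nonneg ε0]
          gcongr
          exact h2.trans (by gcongr)
      _ ≤ (ε + A) * (α + K) * δ := by
          have : 0 ≤ ε * K * δ + A * α * δ := by positivity
          nlinarith

/-- Lyapunov-Schmidt reduction: for small `ε` the equation for the correction `w` of a kink `u` can
be solved up to a multiple of `u'`, with `w` of size `O(ε)`. -/
theorem exists_correction (hf : H1 f) (ha : H2 a) (hu : IsHeteroclinic f 1 0 1 u) :
    ∃ D > 0, ∃ ε₀ > 0, ∀ ε ∈ Set.Ioo 0 ε₀, ∃ (w w₁ w₂ : ℝ → ℝ) (l : ℝ),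
      (∀ z, HasDerivAt w (w₁ z) z) ∧ (∀ z, HasDerivAt w₁ (w₂ z) z) ∧ Continuous w₂ ∧
      (∀ z, |w z| ≤ D * ε) ∧ (∀ z, |w₁ z| ≤ D * ε) ∧
      eLpNorm w 2 ≤ ENNReal.ofReal (D * ε) ∧ eLpNorm w₁ 2 ≤ ENNReal.ofReal (D * ε) ∧
      eLpNorm w₂ 2 ≤ ENNReal.ofReal (D * ε) ∧
      ∀ z, w₂ z + deriv f (u z) * w z = force a f ε u w z - l * deriv u z := by
  obtain ⟨M, μ, Q, hp⟩ := hu.exists_isWeight hf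
  obtain ⟨C, C0, hC⟩ := hp.exists_resolvent_bounds
  obtain ⟨B, B0, Λ, Λ0, hB⟩ := exists_force_bounds hf ha hu
  have hf' := hf.contDiff.continuous_deriv one_le_two
  obtain ⟨K, hK⟩ := isCompact_Icc.exists_bound_of_continuousOn hf'.continuousOn
    (s := Set.Icc (0 : ℝ) 1)
  have K0 : 0 ≤ K := (norm_nonneg _).trans (hK 0 ⟨le_rfl, zero_le_one⟩)
  have hx : ∀ z, u z ∈ Set.Icc (0 : ℝ) 1 := fun z => Set.Ioo_subset_Icc_self (hu.mem_Ioo hf z)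
  set c := 2 * C * B + 2 * (C * Λ * (1 + 2 * C * B))
  have c0 : 0 < c := by positivity
  refine ⟨2 * C * B * (1 + K), by positivity, 1 / c, by positivity, fun ε hε => ?_⟩
  have ε0 : 0 < ε := hε.1
  have hεc : ε * c < 1 := (lt_div_iff₀ c0).1 hε.2
  set A := 2 * C * B * ε with hAdef
  have A0 : 0 ≤ A := by positivity
  have h1 : 0 ≤ ε * (2 * (C * Λ * (1 + 2 * C * B))) := by positivity
  have h2 : 0 ≤ ε * (2 * C * B) := by positivity
  have A1 : A ≤ 1 := by simp only [c, mul_add] at hεc h1 ⊢; linarith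
  -- the smallness condition behind both the invariance of the ball and the contraction property
  have hsm : C * ((ε + A) * Λ) ≤ 1 / 2 := by
    have : C * ((ε + A) * Λ) = ε * (C * Λ * (1 + 2 * C * B)) := by rw [hAdef]; ring
    rw [this]
    simp only [c, mul_add] at hεc h2 ⊢; linarith
  have hinv : C * (ε * B + (ε + A) * Λ * A) ≤ A := by
    have := mul_le_mul_of_nonneg_right hsm A0
    have e : C * (ε * B) = A / 2 := by rw [hAdef]; ring
    linarith
  obtain ⟨hB1, hB2⟩ := hB ε ε0.le A A1
  have hD : A ≤ 2 * C * B * (1 + K) * ε := by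
    have : 0 ≤ 2 * C * B * ε * K := by positivity
    rw [hAdef]; linarith
  have hmap : ∀ w, Continuous w → (∀ z, |w z| ≤ A) → eLpNorm w 2 ≤ ENNReal.ofReal A →
      ∀ {y : ℝ → ℝ}, eLpNorm y 2 ≤ ENNReal.ofReal C * eLpNorm (force a f ε u w) 2 →
        eLpNorm y 2 ≤ ENNReal.ofReal A := fun w hw hA h2 y hy => by
    refine hy.trans ((mul_le_mul_right ((hB1 w hw hA).2 h2) _).trans ?_)
    rw [← ENNReal.ofReal_mul C0.le]
    exact ENNReal.ofReal_le_ofReal hinv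
  obtain ⟨w, hw, hwA, hw2, hfix⟩ := exists_fixedPoint_of_contraction
    (Φ := fun w => resolvent (deriv u) (force a f ε u w)) A0
    (fun w hw hA h2 => by
      have hg := continuous_force hf ha hu ε hw hA
      have hb := (hB1 w hw hA).1
      obtain ⟨r1, -, -, r4, -⟩ := hC _ hg _ hb
      obtain ⟨C', -, hC'⟩ := hp.exists_abs_proj_le
      exact ⟨hp.continuous_solve (hp.continuous_proj hg) (hC' _ _ hb),
        fun z => (r1 z).trans hinv, hmap w hw hA h2 r4⟩)
    (fun w₁ w₂ hw₁ hw₂ hA₁ hA₂ δ hδ z => by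
      have δ0 : 0 ≤ δ := (abs_nonneg _).trans (hδ 0)
      have g₁ := continuous_force hf ha hu ε hw₁ hA₁
      have g₂ := continuous_force hf ha hu ε hw₂ hA₂
      rw [← hp.resolvent_sub g₁ (hB1 w₁ hw₁ hA₁).1 g₂ (hB1 w₂ hw₂ hA₂).1]
      refine ((hC _ (g₁.sub g₂) _ (hB2 w₁ w₂ hA₁ hA₂ δ hδ)).1 z).trans ?_
      have := mul_le_mul_of_nonneg_right hsm δ0
      linarith)
  have hg := continuous_force hf ha hu ε hw hwA
  have hb := (hB1 w hw hwA).1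
  obtain ⟨-, r2, r3, -, r5⟩ := hC _ hg _ hb
  obtain ⟨C', -, hC'⟩ := hp.exists_abs_proj_le
  have hpb := hC' _ _ hb
  have hpc := hp.continuous_proj hg
  set g := force a f ε u w
  have d1 : ∀ z, HasDerivAt w (resolventDeriv (deriv u) (fun z => -f (u z)) g z) z := fun z => by
    have := hp.hasDerivAt_solve hpc hpb z
    change HasDerivAt (resolvent (deriv u) g) _ z at this
    rw [hfix] at this
    refine this.congr_deriv ?_
    rw [resolventDeriv, hfix]
    change _ * resolvent (deriv u) g z + _ = _
    rw [hfix]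
  have d2 : ∀ z, HasDerivAt (resolventDeriv (deriv u) (fun z => -f (u z)) g)
      (proj (deriv u) g z - deriv f (u z) * w z) z := fun z => by
    have hp' : HasDerivAt (fun z => -f (u z)) (-deriv f (u z) * deriv u z) z := by
      have := (((hf.contDiff.differentiable two_ne_zero) (u z)).hasDerivAt.comp z
        (hu.hasDerivAt z)).neg
      exact this.congr_deriv (by ring)
    have := hp.hasDerivAt_deriv_solve hpc hpb hp'
    change HasDerivAt _ (_ - _ * resolvent (deriv u) g z) z at this
    rw [hfix] at this
    exact this
  have hfu : Continuous fun z => deriv f (u z) := hf'.comp hu.1.continuous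
  refine ⟨w, _, _, (∫ s, deriv u s * g s) / (∫ s, deriv u s * deriv u s), d1, d2,
    hpc.sub (hfu.mul hw), fun z => (hwA z).trans hD, fun z => (r2 z).trans (hinv.trans hD),
    hw2.trans (ENNReal.ofReal_le_ofReal hD),
    (hmap w hw hwA hw2 r5).trans (ENNReal.ofReal_le_ofReal hD), ?_, fun z => ?_⟩
  · refine (eLpNorm_sub_le hpc.aestronglyMeasurable (hfu.mul hw).aestronglyMeasurable
      one_le_two).trans ?_
    have e2 : eLpNorm (fun z => deriv f (u z) * w z) 2 ≤ ENNReal.ofReal (K * A) := by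
      refine (eLpNorm_le_mul_eLpNorm_of_ae_le_mul (g := w) (c := K)
        (Eventually.of_forall fun z => ?_) 2).trans ?_
      · rw [norm_mul]
        exact mul_le_mul_of_nonneg_right (hK _ (hx z)) (norm_nonneg _)
      · rw [ENNReal.ofReal_mul K0]
        gcongr
    refine (add_le_add (hmap w hw hwA hw2 r3) e2).trans ?_
    rw [← ENNReal.ofReal_add A0 (by positivity)]
    refine ENNReal.ofReal_le_ofReal (le_of_eq ?_)
    rw [hAdef]; ring
  · simp only [proj]; ring

end

/-! ### Vanishing of the multiplier -/

/-- Functions in `H¹(ℝ)` vanish at infinity, because `w²` and its derivative are integrable. -/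
theorem tendsto_zero_of_memLp_two {w w₁ : ℝ → ℝ} (hd : ∀ z, HasDerivAt w (w₁ z) z)
    (hw : MemLp w 2) (hw₁ : MemLp w₁ 2) : Tendsto w atBot (𝓝 0) ∧ Tendsto w atTop (𝓝 0) := by
  have hd2 : ∀ z, HasDerivAt (fun z => w z ^ 2) (2 * (w z * w₁ z)) z := fun z =>
    ((hd z).pow 2).congr_deriv (by simp; ring)
  have hi : Integrable fun z => 2 * (w z * w₁ z) := (hw.integrable_mul hw₁).const_mul 2
  have hi2 : Integrable fun z => w z ^ 2 := hw.integrable_sq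
  have key : ∀ l : Filter ℝ, Tendsto (fun z => w z ^ 2) l (𝓝 0) → Tendsto w l (𝓝 0) :=
    fun l h => by
      rw [tendsto_zero_iff_abs_tendsto_zero]
      have := (Real.continuous_sqrt.tendsto 0).comp h
      rw [Real.sqrt_zero] at this
      exact this.congr fun z => Real.sqrt_sq_eq_abs _
  exact ⟨key _ (tendsto_zero_of_hasDerivAt_of_integrableOn_Iic (a := 0) (fun z _ => hd2 z)
      hi.integrableOn hi2.integrableOn),
    key _ (tendsto_zero_of_hasDerivAt_of_integrableOn_Ioi (a := 0) (fun z _ => hd2 z)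
      hi.integrableOn hi2.integrableOn)⟩

theorem memLp_translate_sub {v v₁ : ℝ → ℝ} (hd : ∀ z, HasDerivAt v (v₁ z) z)
    (hc : Continuous v₁) (h2 : MemLp v₁ 2) (c : ℝ) : MemLp (fun z => v (z + c) - v z) 2 := by
  have hv : Continuous v := continuous_iff_continuousAt.2 fun z => (hd z).continuousAt
  refine ⟨(Continuous.sub (by fun_prop) hv).aestronglyMeasurable, ?_⟩
  exact (eLpNorm_translate_sub_le hd hc c).trans_lt
    (ENNReal.mul_lt_top enorm_lt_top h2.eLpNorm_lt_top)

/-- The pairing of the increment of `v` by `-c` with `v'` is odd in `c`, because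
`(v(z + c) - v(z)) (v'(z + c) - v'(z))` is a total derivative. -/
theorem integral_increment_mul_deriv_odd {v v₁ v₂ : ℝ → ℝ} (hd : ∀ z, HasDerivAt v (v₁ z) z)
    (hd₁ : ∀ z, HasDerivAt v₁ (v₂ z) z) (h₁ : MemLp v₁ 2) (c : ℝ) :
    ∫ z, (v (z + c) - v z) * v₁ z = - ∫ z, (v (z - c) - v z) * v₁ z := by
  have hc : Continuous v₁ := continuous_iff_continuousAt.2 fun z => (hd₁ z).continuousAt
  have hD := memLp_translate_sub hd hc h₁ c
  have hs : MemLp (fun z => v₁ (z + c)) 2 :=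
    h₁.comp_measurePreserving (measurePreserving_add_right volume c)
  have e1 : ∫ z, (v (z - c) - v z) * v₁ z = ∫ z, (v z - v (z + c)) * v₁ (z + c) := by
    rw [← integral_add_right_eq_self (fun z => (v (z - c) - v z) * v₁ z) c]
    simp
  have i1 : Integrable fun z => (v (z + c) - v z) * v₁ z := hD.integrable_mul h₁
  have i2 : Integrable fun z => (v (z + c) - v z) * v₁ (z + c) := hD.integrable_mul hs
  have hdd : ∀ z, HasDerivAt (fun z => v (z + c) - v z) (v₁ (z + c) - v₁ z) z := fun z =>
    ((hd (z + c)).comp_add_const z c).sub (hd z)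
  have h0 : ∫ z, 2 * ((v (z + c) - v z) * v₁ (z + c) - (v (z + c) - v z) * v₁ z) = 0 := by
    refine integral_eq_zero_of_hasDerivAt_of_integrable (f := fun z => (v (z + c) - v z) ^ 2)
      (fun z => ((hdd z).pow 2).congr_deriv (by simp; ring)) ((i2.sub i1).const_mul 2)
      hD.integrable_sq
  rw [integral_const_mul, integral_sub i2 i1] at h0
  have e2 : ∫ z, (v z - v (z + c)) * v₁ (z + c) = - ∫ z, (v (z + c) - v z) * v₁ (z + c) := by
    rw [← integral_neg]; congr 1; funext z; ring
  rw [e1, e2]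
  linarith

theorem integral_abs_mul_le {x y : ℝ → ℝ} (hx : MemLp x 2) (hy : MemLp y 2) :
    ∫ z, ‖x z * y z‖ ≤ (eLpNorm x 2 volume).toReal * (eLpNorm y 2 volume).toReal := by
  rw [integral_norm_eq_lintegral_enorm (f := fun z => x z * y z) (hx.1.mul hy.1), ← ENNReal.toReal_mul]
  refine ENNReal.toReal_mono (ENNReal.mul_ne_top hx.2.ne hy.2.ne) ?_
  rw [← ENNReal.pow_le_pow_left_iff two_ne_zero, mul_pow, eLpNorm_two_sq, eLpNorm_two_sq]
  simp only [enorm_mul]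
  exact sq_lintegral_mul_le _ hx.1.enorm hy.1.enorm

/-- The coupling is the gradient of a translation invariant functional, because the coefficients
are even; it is therefore orthogonal to `v'`. -/
theorem H2.integral_coupling_mul_deriv {a : ℤ → ℝ} (ha : H2 a) {v v₁ v₂ : ℝ → ℝ} {A : ℝ}
    (hA : ∀ z, |v z| ≤ A) (hd : ∀ z, HasDerivAt v (v₁ z) z)
    (hd₁ : ∀ z, HasDerivAt v₁ (v₂ z) z) (h₁ : MemLp v₁ 2) :
    ∫ z, coupling a v z * v₁ z = 0 := by
  have hc : Continuous v₁ := continuous_iff_continuousAt.2 fun z => (hd₁ z).continuousAt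
  have hinc : ∀ k : ℤ, MemLp (fun z => v (z - k) - v z) 2 := fun k => by
    simpa [sub_eq_add_neg] using memLp_translate_sub hd hc h₁ (-(k : ℝ))
  set N := (eLpNorm v₁ 2 volume).toReal
  have hb : ∀ k : ℤ, ∫ z, ‖(v (z - k) - v z) * v₁ z‖ ≤ |(k : ℝ)| * N * N := fun k => by
    refine (integral_abs_mul_le (hinc k) h₁).trans ?_
    gcongr
    have h := eLpNorm_translate_sub_le hd hc (-(k : ℝ))
    have h' := ENNReal.toReal_mono (ENNReal.mul_ne_top enorm_ne_top h₁.2.ne) h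
    rw [ENNReal.toReal_mul, toReal_enorm, norm_neg] at h'
    simpa [sub_eq_add_neg] using h'
  set b : ℤ → ℝ := fun k => ∫ z, (v (z - k) - v z) * v₁ z
  have hsum : HasSum (fun k : ℤ => a k * b k) (∫ z, coupling a v z * v₁ z) := by
    have h := hasSum_integral_of_summable_integral_norm (μ := volume)
      (F := fun (k : ℤ) z => a k * ((v (z - k) - v z) * v₁ z))
      (fun k => ((hinc k).integrable_mul h₁).const_mul (a k)) ?_
    · have e1 : ∀ z, ∑' k : ℤ, a k * ((v (z - k) - v z) * v₁ z) = coupling a v z * v₁ z :=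
        fun z => by
          simp only [← mul_assoc]
          exact ((ha.hasSum_increment hA z).mul_right (v₁ z)).tsum_eq
      simpa only [e1, integral_const_mul] using h
    · refine Summable.of_nonneg_of_le (fun k => integral_nonneg fun z => norm_nonneg _)
        (fun k => ?_) (ha.summable_moment.mul_right (N * N))
      simp only [norm_mul (a k)]
      rw [integral_const_mul]
      calc _ ≤ ‖a k‖ * (|(k : ℝ)| * N * N) := by gcongr; exact hb k
        _ = _ := by rw [Real.norm_eq_abs]; ring
  have hsum' := (Equiv.neg ℤ).hasSum_iff.2 hsum
  have e : ∀ k : ℤ, ((fun k : ℤ => a k * b k) ∘ Equiv.neg ℤ) k = -(a k * b k) := fun k => by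
    have h := integral_increment_mul_deriv_odd hd hd₁ h₁ (k : ℝ)
    simp only [Function.comp_apply, Equiv.neg_apply, ← ha.symm k, b, Int.cast_neg, sub_neg_eq_add]
    rw [h]; ring
  rw [funext e] at hsum'
  have h := hsum'.unique hsum.neg
  linarith

section

variable {a : ℤ → ℝ} {f u w w₁ w₂ : ℝ → ℝ} {A l ε : ℝ}

/-- The second derivative `-f(u)` of a kink is square integrable. -/
theorem IsHeteroclinic.memLp_deriv_deriv (hf : H1 f) (hu : IsHeteroclinic f 1 0 1 u) :
    MemLp (fun z => -f (u z)) 2 := by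
  obtain ⟨M, μ, Q, hp⟩ := hu.exists_isWeight hf
  refine MemLp.of_le_mul (c := Q) hp.memLp hp.continuous_deriv.aestronglyMeasurable
    (Eventually.of_forall fun z => ?_)
  rw [Real.norm_eq_abs, Real.norm_of_nonneg (hp.pos z).le]
  exact hp.abs_deriv_le z

theorem IsHeteroclinic.connects_add (hu : IsHeteroclinic f 1 0 1 u)
    (hd : ∀ z, HasDerivAt w (w₁ z) z) (hw : MemLp w 2) (hw₁ : MemLp w₁ 2) :
    Connects 0 1 fun z => u z + w z := by
  obtain ⟨h1, h2⟩ := tendsto_zero_of_memLp_two hd hw hw₁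
  exact ⟨by simpa using hu.2.2.1.add h1, by simpa using hu.2.2.2.add h2⟩

/-- The multiplier of the Lyapunov-Schmidt reduction vanishes: testing the equation with the
derivative of its solution `u + w`, the local terms form the total derivative of the energy and the
coupling drops out by symmetry. -/
theorem multiplier_eq_zero (hf : H1 f) (ha : H2 a) (hu : IsHeteroclinic f 1 0 1 u)
    (hd : ∀ z, HasDerivAt w (w₁ z) z) (hd₁ : ∀ z, HasDerivAt w₁ (w₂ z) z)
    (hA : ∀ z, |w z| ≤ A) (hA₁ : ∀ z, |w₁ z| ≤ A) (hw : MemLp w 2) (hw₁ : MemLp w₁ 2)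
    (hw₂ : MemLp w₂ 2)
    (heq : ∀ z, w₂ z + deriv f (u z) * w z = force a f ε u w z - l * deriv u z)
    (hsm : (∫ z, deriv u z) * A < ∫ z, deriv u z * deriv u z) : l = 0 := by
  obtain ⟨M, μ, Q, hp⟩ := hu.exists_isWeight hf
  have hF := hasDerivAt_primitive hf.contDiff.continuous
  set v : ℝ → ℝ := fun z => u z + w z
  set v₁ : ℝ → ℝ := fun z => deriv u z + w₁ z with hv₁
  set v₂ : ℝ → ℝ := fun z => -f (u z) + w₂ z with hv₂
  have vd : ∀ z, HasDerivAt v (v₁ z) z := fun z => (hu.hasDerivAt z).add (hd z)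
  have vd₁ : ∀ z, HasDerivAt v₁ (v₂ z) z := fun z => (hu.hasDerivAt_deriv z).add (hd₁ z)
  have hc : Continuous v := continuous_iff_continuousAt.2 fun z => (vd z).continuousAt
  have hc₁ : Continuous v₁ := continuous_iff_continuousAt.2 fun z => (vd₁ z).continuousAt
  have m₁ : MemLp v₁ 2 := hp.memLp.add hw₁
  have m₂ : MemLp v₂ 2 := (hu.memLp_deriv_deriv hf).add hw₂
  have hv : ∀ z, |v z| ≤ 1 + A := fun z =>
    (abs_add_le _ _).trans (add_le_add (hu.abs_le_one hf z) (hA z))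
  have hS : MemLp (coupling a v) 2 := ⟨(ha.continuous_coupling hc hv).aestronglyMeasurable,
    (ha.eLpNorm_coupling_le_deriv vd hc₁ hv).trans_lt
      (ENNReal.mul_lt_top ENNReal.ofReal_lt_top m₁.2)⟩
  have heq' : ∀ z, v₂ z + f (v z) = ε * coupling a v z - l * deriv u z := fun z => by
    have h1 := heq z
    have h2 := ha.coupling_add (hu.abs_le_one hf) hA z
    simp only [force, remainder] at h1
    simp only [v, v₂, h2]
    linarith
  have i1 : Integrable fun z => coupling a v z * v₁ z := hS.integrable_mul m₁
  have i2 : Integrable fun z => deriv u z * v₁ z := hp.memLp.integrable_mul m₁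
  have hE : ∀ z, HasDerivAt (fun z => v₁ z ^ 2 / 2 + primitive f (v z))
      (ε * (coupling a v z * v₁ z) - l * (deriv u z * v₁ z)) z := fun z => by
    have h := (((vd₁ z).pow 2).div_const 2).add ((hF (v z)).comp z (vd z))
    refine h.congr_deriv ?_
    have := heq' z
    simp only [Nat.cast_ofNat, Nat.add_one_sub_one, pow_one]
    calc _ = (v₂ z + f (v z)) * v₁ z := by ring
      _ = _ := by rw [this]; ring
  have hlim : ∀ (L : Filter ℝ) (e : ℝ), Tendsto v L (𝓝 e) → Tendsto v₁ L (𝓝 0) →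
      primitive f e = 0 → Tendsto (fun z => v₁ z ^ 2 / 2 + primitive f (v z)) L (𝓝 0) :=
    fun L e h1 h2 h3 => by
      have h4 := ((hF e).continuousAt.tendsto.comp h1)
      rw [h3] at h4
      simpa using ((h2.pow 2).div_const 2).add h4
  obtain ⟨t0, t1⟩ := hu.connects_add hd hw hw₁
  obtain ⟨s0, s1⟩ := tendsto_zero_of_memLp_two vd₁ m₁ m₂
  have h0 := integral_of_hasDerivAt_of_tendsto hE ((i1.const_mul ε).sub (i2.const_mul l))
    (hlim _ 0 t0 s0 (primitive_zero f)) (hlim _ 1 t1 s1 hf.primitive_one)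
  rw [integral_sub (i1.const_mul ε) (i2.const_mul l), integral_const_mul, integral_const_mul,
    ha.integral_coupling_mul_deriv hv vd vd₁ m₁] at h0
  have i3 : Integrable fun z => deriv u z * w₁ z := hp.memLp.integrable_mul hw₁
  have e3 : ∫ z, deriv u z * v₁ z = (∫ z, deriv u z * deriv u z) + ∫ z, deriv u z * w₁ z := by
    rw [← integral_add hp.integrable_sq i3]
    congr 1; funext z; simp only [hv₁]; ring
  have h4 := (abs_le.1 (hp.abs_integral_mul_le hA₁)).1
  have hpos : 0 < ∫ z, deriv u z * v₁ z := by rw [e3]; linarith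
  have : l * ∫ z, deriv u z * v₁ z = 0 := by linarith
  exact (mul_eq_zero.1 this).resolve_right hpos.ne'

end

/-! ### Sobolev norms -/

theorem hasWeakDeriv_of_hasDerivAt {g h : ℝ → ℝ} (hd : ∀ z, HasDerivAt g (h z) z)
    (hc : Continuous h) : HasWeakDeriv g h := by
  have hg : Continuous g := continuous_iff_continuousAt.2 fun z => (hd z).continuousAt
  refine ⟨hg.locallyIntegrable, hc.locallyIntegrable, fun φ hφ hs => ?_⟩
  have h1 : Continuous (deriv φ) := hφ.continuous_deriv (by simp)
  have h := integral_mul_deriv_eq_deriv_mul_of_integrable (u := g) (v := φ) (u' := h)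
    (v' := deriv φ) (fun z _ => hd z)
    (fun z _ => ((hφ.differentiable (by simp)) z).hasDerivAt)
    ((hg.mul h1).integrable_of_hasCompactSupport hs.deriv.mul_left)
    ((hc.mul hφ.continuous).integrable_of_hasCompactSupport hs.mul_left)
    ((hg.mul hφ.continuous).integrable_of_hasCompactSupport hs.mul_left)
  simpa only [mul_comm] using h

theorem tripleNorm_le {w w₁ w₂ : ℝ → ℝ} {A : ℝ} (hA : 0 ≤ A)
    (h : eLpNorm w 2 ≤ ENNReal.ofReal A) (h₁ : eLpNorm w₁ 2 ≤ ENNReal.ofReal A)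
    (h₂ : eLpNorm w₂ 2 ≤ ENNReal.ofReal A) : tripleNorm w w₁ w₂ ≤ ENNReal.ofReal (2 * A) := by
  have h3 : eLpNorm w 2 volume ^ 2 + eLpNorm w₁ 2 volume ^ 2 + eLpNorm w₂ 2 volume ^ 2 ≤
      ENNReal.ofReal (2 * A) ^ 2 := by
    refine (add_le_add (add_le_add (pow_le_pow_left' h 2) (pow_le_pow_left' h₁ 2))
      (pow_le_pow_left' h₂ 2)).trans ?_
    rw [← ENNReal.ofReal_pow hA, ← ENNReal.ofReal_pow (by positivity),
      ← ENNReal.ofReal_add (by positivity) (by positivity),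
      ← ENNReal.ofReal_add (by positivity) (by positivity)]
    refine ENNReal.ofReal_le_ofReal ?_
    -- The constant is `√3 ≤ 2`.
    nlinarith [sq_nonneg A]
  refine (ENNReal.rpow_le_rpow h3 (by norm_num)).trans (le_of_eq ?_)
  rw [← ENNReal.rpow_natCast, ← ENNReal.rpow_mul]
  norm_num

theorem isH2Triple_const_mul {w w₁ w₂ : ℝ → ℝ} (h : IsH2Triple w w₁ w₂) (b : ℝ) :
    IsH2Triple (fun z => b * w z) (fun z => b * w₁ z) (fun z => b * w₂ z) := by
  have key : ∀ {g k : ℝ → ℝ}, HasWeakDeriv g k →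
      HasWeakDeriv (fun z => b * g z) (fun z => b * k z) := fun {g k} hgk => by
    refine ⟨hgk.1.smul b, hgk.2.1.smul b, fun φ hφ hs => ?_⟩
    have := hgk.2.2 φ hφ hs
    simp only [mul_left_comm _ b]
    rw [integral_const_mul, integral_const_mul, this, mul_neg]
  exact ⟨h.1.const_mul b, h.2.1.const_mul b, h.2.2.1.const_mul b, key h.2.2.2.1, key h.2.2.2.2⟩

theorem h2Norm_const_mul_le {w : ℝ → ℝ} (h : MemH2 w) {b A : ℝ} (hb : 0 ≤ b)
    (hA : h2Norm w ≤ ENNReal.ofReal A) :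
    MemH2 (fun z => b * w z) ∧ h2Norm (fun z => b * w z) ≤ ENNReal.ofReal (b * A) := by
  obtain ⟨w₁, w₂, ht⟩ := h
  have ht' := isH2Triple_const_mul ht b
  refine ⟨⟨_, _, ht'⟩, ?_⟩
  rw [h2Norm_eq ht] at hA
  rw [h2Norm_eq ht', ENNReal.ofReal_mul hb]
  refine le_trans (le_of_eq ?_) (mul_le_mul_right hA _)
  have key : ∀ g : ℝ → ℝ, eLpNorm (fun z => b * g z) 2 volume ^ 2 =
      ENNReal.ofReal b ^ 2 * eLpNorm g 2 volume ^ 2 := fun g => by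
    change eLpNorm (b • g) 2 volume ^ 2 = _
    rw [eLpNorm_const_smul, mul_pow, Real.enorm_of_nonneg hb]
  rw [tripleNorm, tripleNorm, key, key, key, ← mul_add, ← mul_add,
    ENNReal.mul_rpow_of_nonneg _ _ (by norm_num : (0 : ℝ) ≤ 1 / 2)]
  congr 1
  rw [← ENNReal.rpow_natCast, ← ENNReal.rpow_mul]
  norm_num

/-! ### Weakly coupled kinks -/

theorem solvesLattice_wave {a : ℤ → ℝ} {f u : ℝ → ℝ} {ε : ℝ} (h : SolvesNonlocal a f ε u) :
    SolvesLattice a f ε (wave 1 u) := by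
  intro n
  have hd : ∀ t, HasDerivAt u (deriv u t) t := fun t =>
    (h.1.differentiable two_ne_zero t).hasDerivAt
  have hd1 : ∀ t, HasDerivAt (deriv u) (deriv (deriv u) t) t := fun t =>
    ((h.1.deriv' (n := 1)).differentiable one_ne_zero t).hasDerivAt
  have hlin : ∀ t : ℝ, HasDerivAt (fun t : ℝ => (n : ℝ) - 1 * t) (-1) t := fun t => by
    simpa using ((hasDerivAt_id' t).const_mul 1).const_sub (n : ℝ)
  have e1 : deriv (wave 1 u n) = fun t => -deriv u (n - 1 * t) := funext fun t => by
    have := (hd (n - 1 * t)).comp t (hlin t)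
    exact (this.congr_deriv (by ring)).deriv
  have e2 : ∀ t, deriv (fun t => -deriv u (n - 1 * t)) t = deriv (deriv u) (n - 1 * t) :=
    fun t => by
      have := ((hd1 (n - 1 * t)).comp t (hlin t)).neg
      exact (this.congr_deriv (by ring)).deriv
  have e3 : ∀ t (k : ℤ), wave 1 u (n - k) t = u (n - 1 * t - k) := fun t k => by
    simp only [wave]; congr 1; push_cast; ring
  refine ⟨h.1.comp (by fun_prop), fun t => ?_⟩
  simp only [e3]
  rw [e1, e2]
  exact h.2 (n - 1 * t)

theorem exists_kink_near {a : ℤ → ℝ} {f u₀ : ℝ → ℝ} (hf : H1 f) (ha : H2 a)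
    (hu : IsHeteroclinic f 1 0 1 u₀) :
    ∃ C > (0 : ℝ), ∃ ε₀ > (0 : ℝ), ∀ ε ∈ Set.Ioo 0 ε₀, ∃ u : ℝ → ℝ,
      SolvesNonlocal a f ε u ∧ MemH2 (fun z => u z - u₀ z) ∧
      h2Norm (fun z => u z - u₀ z) ≤ ENNReal.ofReal (C * ε) ∧ Connects 0 1 u := by
  obtain ⟨D, D0, ε₁, ε₁0, hD⟩ := exists_correction hf ha hu
  obtain ⟨M, μ, Q, hp⟩ := hu.exists_isWeight hf
  have hP := hp.integral_sq_pos
  have hI : 0 ≤ ∫ z, deriv u₀ z := integral_nonneg fun z => (hp.pos z).le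
  set P := ∫ z, deriv u₀ z * deriv u₀ z
  set I := ∫ z, deriv u₀ z
  have hden : 0 < (I + 1) * D := by positivity
  refine ⟨2 * D, by positivity, min ε₁ (P / ((I + 1) * D)), by positivity, fun ε hε => ?_⟩
  have ε0 : 0 < ε := hε.1
  obtain ⟨w, w₁, w₂, l, hd, hd₁, hc₂, hA, hA₁, n0, n1, n2, heq⟩ :=
    hD ε ⟨ε0, hε.2.trans_le (min_le_left _ _)⟩
  have hsm : I * (D * ε) < P := by
    have h1 := (lt_div_iff₀ hden).1 (hε.2.trans_le (min_le_right _ _))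
    have h2 : 0 < D * ε := by positivity
    linarith
  have hc₁ : Continuous w₁ := continuous_iff_continuousAt.2 fun z => (hd₁ z).continuousAt
  have hc : Continuous w := continuous_iff_continuousAt.2 fun z => (hd z).continuousAt
  have m0 : MemLp w 2 := ⟨hc.aestronglyMeasurable, n0.trans_lt ENNReal.ofReal_lt_top⟩
  have m1 : MemLp w₁ 2 := ⟨hc₁.aestronglyMeasurable, n1.trans_lt ENNReal.ofReal_lt_top⟩
  have m2 : MemLp w₂ 2 := ⟨hc₂.aestronglyMeasurable, n2.trans_lt ENNReal.ofReal_lt_top⟩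
  have hl := multiplier_eq_zero hf ha hu hd hd₁ hA hA₁ m0 m1 m2 heq hsm
  have ht : IsH2Triple w w₁ w₂ := ⟨m0, m1, m2, hasWeakDeriv_of_hasDerivAt hd hc₁,
    hasWeakDeriv_of_hasDerivAt hd₁ hc₂⟩
  have ew : (fun z => u₀ z + w z - u₀ z) = w := funext fun z => add_sub_cancel_left _ _
  have vd : ∀ z, HasDerivAt (fun z => u₀ z + w z) (deriv u₀ z + w₁ z) z := fun z =>
    (hu.hasDerivAt z).add (hd z)
  have vd₁ : ∀ z, HasDerivAt (fun z => deriv u₀ z + w₁ z) (-f (u₀ z) + w₂ z) z := fun z =>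
    (hu.hasDerivAt_deriv z).add (hd₁ z)
  have hv : ∀ z, |u₀ z + w z| ≤ 1 + D * ε := fun z =>
    (abs_add_le _ _).trans (add_le_add (hu.abs_le_one hf z) (hA z))
  refine ⟨fun z => u₀ z + w z, ⟨contDiff_two_of_hasDerivAt vd vd₁ (hp.continuous_deriv.add hc₂),
    fun z => ⟨ha.summable_mul hv z, ?_⟩⟩, ?_, ?_, hu.connects_add hd m0 m1⟩
  · rw [show deriv (fun z => u₀ z + w z) = fun z => deriv u₀ z + w₁ z from
      funext fun z => (vd z).deriv, (vd₁ z).deriv]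
    have h1 := heq z
    have h2 := ha.coupling_add (hu.abs_le_one hf) hA z
    rw [hl] at h1
    simp only [force, remainder] at h1
    change _ - ε * coupling a (fun z => u₀ z + w z) z + _ = _
    rw [h2]
    linarith
  · rw [ew]; exact ⟨w₁, w₂, ht⟩
  · rw [ew, h2Norm_eq ht, mul_assoc]
    exact tripleNorm_le (by positivity) n0 n1 n2

/-! ### Nearest neighbour lattices -/

/-- The coefficients `1, -2, 1` of the discrete Laplacian. -/
def laplacian (k : ℤ) : ℝ := if k = 0 then -2 else if k = 1 ∨ k = -1 then 1 else 0

theorem laplacian_eq_zero {k : ℤ} (hk : k ∉ ({-1, 0, 1} : Finset ℤ)) : laplacian k = 0 := by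
  simp only [Finset.mem_insert, Finset.mem_singleton, not_or] at hk
  simp [laplacian, hk]

theorem h2_laplacian : H2 laplacian where
  sum_eq_zero := by
    have h : HasSum laplacian (∑ k ∈ ({-1, 0, 1} : Finset ℤ), laplacian k) :=
      hasSum_sum_of_ne_finset_zero fun k hk => laplacian_eq_zero hk
    have e : ∑ k ∈ ({-1, 0, 1} : Finset ℤ), laplacian k = 0 := by
      simp [laplacian]; norm_num
    rwa [e] at h
  neg := by simp [laplacian]
  symm k := by
    simp only [laplacian]
    split_ifs <;> first | rfl | omega
  summable := by
    refine summable_of_ne_finset_zero (s := Finset.range 2) fun k hk => ?_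
    rw [Finset.mem_range] at hk
    rw [laplacian_eq_zero]
    · simp
    · simp only [Finset.mem_insert, Finset.mem_singleton]; omega

theorem tsum_laplacian (u : ℝ → ℝ) (z : ℝ) :
    ∑' k : ℤ, laplacian k * u (z - k) = u (z + 1) - 2 * u z + u (z - 1) := by
  rw [tsum_eq_sum (s := {-1, 0, 1}) fun k hk => by rw [laplacian_eq_zero hk, zero_mul]]
  simp [laplacian]
  ring

/-- The force `g` in the variable `u`, where `v = α + (β - α) u`, for waves of speed `c`. -/
def rescale (g : ℝ → ℝ) (α β c : ℝ) (u : ℝ) : ℝ := g (α + (β - α) * u) / (c ^ 2 * (β - α))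

section Rescale

variable {g G : ℝ → ℝ} {α β c : ℝ}

/-- Hypothesis (H1) for the rescaled force, read off from any primitive `G` of `g`: the potential
`G` takes the same value at `α` and `β`, and a different value in between. -/
theorem h1_rescale (hg : ContDiff ℝ 2 g) (hG : ∀ v, HasDerivAt G (g v) v) (hαβ : α < β)
    (hc : c ≠ 0) (gα : g α = 0) (gβ : g β = 0) (dα : deriv g α < 0) (dβ : deriv g β < 0)
    (hGβ : G β = G α) (hne : ∀ v ∈ Set.Ioo α β, G v ≠ G α) : H1 (rescale g α β c) := by
  have hb : 0 < β - α := sub_pos.2 hαβ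
  have hc2 : 0 < c ^ 2 := by positivity
  have hlin : ∀ u : ℝ, HasDerivAt (fun u => α + (β - α) * u) (β - α) u := fun u => by
    simpa using ((hasDerivAt_id' u).const_mul (β - α)).const_add α
  have hcd : ContDiff ℝ 2 (rescale g α β c) := by
    refine ContDiff.div_const (hg.comp ?_) _
    fun_prop
  have hd : ∀ u, deriv (rescale g α β c) u = deriv g (α + (β - α) * u) / c ^ 2 := fun u => by
    have h := ((hg.differentiable two_ne_zero (α + (β - α) * u)).hasDerivAt.comp u
      (hlin u)).div_const (c ^ 2 * (β - α))
    refine (h.congr_deriv ?_).deriv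
    field_simp
  have hprim : ∀ u, primitive (rescale g α β c) u =
      (G (α + (β - α) * u) - G α) / (c ^ 2 * (β - α) ^ 2) := fun u => by
    have h : ∀ x, HasDerivAt (fun x => G (α + (β - α) * x) / (c ^ 2 * (β - α) ^ 2))
        (rescale g α β c x) x := fun x => by
      refine (((hG (α + (β - α) * x)).comp x (hlin x)).div_const _).congr_deriv ?_
      rw [rescale]
      field_simp
    rw [primitive, intervalIntegral.integral_eq_sub_of_hasDerivAt (fun x _ => h x)
      (hcd.continuous.intervalIntegrable _ _)]
    simp [sub_div]
  have eβ : α + (β - α) * 1 = β := by ring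
  have eα : α + (β - α) * 0 = α := by ring
  refine ⟨hcd, by rw [rescale, eα, gα, zero_div], by rw [rescale, eβ, gβ, zero_div], ?_, ?_, ?_,
    fun u hu => ?_⟩
  · rw [hd, eα]; exact div_neg_of_neg_of_pos dα hc2
  · rw [hd, eβ]; exact div_neg_of_neg_of_pos dβ hc2
  · rw [hprim, eβ, hGβ, sub_self, zero_div]
  · rw [hprim]
    refine div_ne_zero (sub_ne_zero.2 (hne _ ⟨?_, ?_⟩)) (by positivity)
    · nlinarith [hu.1]
    · nlinarith [hu.2]

theorem deriv_affine {u : ℝ → ℝ} (hu : ContDiff ℝ 2 u) (r s : ℝ) (z : ℝ) :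
    deriv (deriv fun z => r + s * u z) z = s * deriv (deriv u) z := by
  have e : deriv (fun z => r + s * u z) = fun z => s * deriv u z := funext fun z => by
    rw [deriv_const_add, deriv_const_mul _ (hu.differentiable two_ne_zero z)]
  rw [e, deriv_const_mul _ ((hu.deriv' (n := 1)).differentiable one_ne_zero z)]

theorem IsHeteroclinic.of_rescale {u : ℝ → ℝ} (hαβ : α < β) (hc : c ≠ 0)
    (hu : IsHeteroclinic (rescale g α β c) 1 0 1 u) :
    IsHeteroclinic g c α β fun z => α + (β - α) * u z := by
  have hb : β - α ≠ 0 := (sub_pos.2 hαβ).ne'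
  refine ⟨contDiff_const.add (contDiff_const.mul hu.1), fun z => ?_, ?_, ?_⟩
  · have h := hu.2.1 z
    rw [deriv_affine hu.1]
    rw [rescale] at h
    field_simp at h
    linarith
  · simpa using (hu.2.2.1.const_mul (β - α)).const_add α
  · simpa using (hu.2.2.2.const_mul (β - α)).const_add α

theorem IsHeteroclinic.rescale {V : ℝ → ℝ} (hαβ : α < β) (hc : c ≠ 0)
    (hV : IsHeteroclinic g c α β V) :
    IsHeteroclinic (rescale g α β c) 1 0 1 fun z => -(α / (β - α)) + (β - α)⁻¹ * V z := by
  have hb : β - α ≠ 0 := (sub_pos.2 hαβ).ne'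
  refine ⟨contDiff_const.add (contDiff_const.mul hV.1), fun z => ?_, ?_, ?_⟩
  · have h := hV.2.1 z
    rw [deriv_affine hV.1, Kink.rescale,
      show α + (β - α) * (-(α / (β - α)) + (β - α)⁻¹ * V z) = V z by field_simp; ring]
    field_simp
    linarith
  · have h := (hV.2.2.1.const_mul (β - α)⁻¹).const_add (-(α / (β - α)))
    rwa [show -(α / (β - α)) + (β - α)⁻¹ * α = 0 by field_simp; ring] at h
  · have h := (hV.2.2.2.const_mul (β - α)⁻¹).const_add (-(α / (β - α)))
    rwa [show -(α / (β - α)) + (β - α)⁻¹ * β = 1 by field_simp; ring] at h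

theorem solvesNearestNeighbour_wave {V : ℝ → ℝ} {κ : ℝ} (hV : ContDiff ℝ 2 V)
    (h : ∀ z, c ^ 2 * deriv (deriv V) z - κ * (V (z + 1) - 2 * V z + V (z - 1)) + g (V z) = 0) :
    SolvesNearestNeighbour g κ (wave c V) := by
  intro n
  have hlin : ∀ t : ℝ, HasDerivAt (fun t : ℝ => (n : ℝ) - c * t) (-c) t := fun t => by
    simpa using ((hasDerivAt_id' t).const_mul c).const_sub (n : ℝ)
  have e1 : deriv (wave c V n) = fun t => -c * deriv V (n - c * t) := funext fun t => by
    have := (hV.differentiable two_ne_zero (n - c * t)).hasDerivAt.comp t (hlin t)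
    exact (this.congr_deriv (mul_comm _ _)).deriv
  have e2 : ∀ t, deriv (fun t => -c * deriv V (n - c * t)) t =
      c ^ 2 * deriv (deriv V) (n - c * t) := fun t => by
    have := ((((hV.deriv' (n := 1)).differentiable one_ne_zero (n - c * t)).hasDerivAt).comp t
      (hlin t)).const_mul (-c)
    exact (this.congr_deriv (by ring)).deriv
  refine ⟨hV.comp (by fun_prop), fun t => ?_⟩
  rw [e1, e2]
  have h1 := h (n - c * t)
  have e3 : wave c V (n + 1) t = V (n - c * t + 1) := by
    simp only [wave]; congr 1; push_cast; ring
  have e4 : wave c V (n - 1) t = V (n - c * t - 1) := by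
    simp only [wave]; congr 1; push_cast; ring
  rw [e3, e4]
  exact h1

/-- The affine change `v = α + (β - α) u` turns `c² V'' + g(V) = 0` into `u'' + f(u) = 0` with the
rescaled force `f`, and the coupling strength `κ` into `ε = κ / c²`. -/
theorem hasWeakCouplingKinks_of_rescale (hαβ : α < β) (hc : c ≠ 0)
    (hf : H1 (rescale g α β c)) : HasWeakCouplingKinks g α β c := by
  have hb : 0 < β - α := sub_pos.2 hαβ
  have hc2 : 0 < c ^ 2 := by positivity
  obtain ⟨u₀, hu₀⟩ := hf.exists_isHeteroclinic
  refine ⟨⟨_, hu₀.of_rescale hαβ hc⟩, fun V₀ hV₀ => ?_⟩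
  obtain ⟨C, C0, ε₀, ε₀0, hC⟩ := exists_kink_near hf h2_laplacian (hV₀.rescale hαβ hc)
  refine ⟨(β - α) * (C / c ^ 2), by positivity, ε₀ * c ^ 2, by positivity, fun κ hκ => ?_⟩
  obtain ⟨u, ⟨hu, hsol⟩, hmem, hnorm, hconn⟩ :=
    hC (κ / c ^ 2) ⟨div_pos hκ.1 hc2, (div_lt_iff₀ hc2).2 hκ.2⟩
  have e : (fun z => α + (β - α) * u z - V₀ z) =
      fun z => (β - α) * (u z - (-(α / (β - α)) + (β - α)⁻¹ * V₀ z)) := funext fun z => by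
    field_simp; ring
  have hV : ContDiff ℝ 2 fun z => α + (β - α) * u z := contDiff_const.add (contDiff_const.mul hu)
  obtain ⟨hm, hn⟩ := h2Norm_const_mul_le hmem hb.le hnorm
  refine ⟨fun z => α + (β - α) * u z, hV, ⟨?_, ?_⟩, solvesNearestNeighbour_wave hV fun z => ?_,
    e ▸ hm, ?_⟩
  · simpa using (hconn.1.const_mul (β - α)).const_add α
  · simpa using (hconn.2.const_mul (β - α)).const_add α
  · have h := (hsol z).2
    rw [tsum_laplacian, rescale] at h
    rw [deriv_affine hu]
    generalize g (α + (β - α) * u z) = y at h ⊢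
    field_simp at h
    linarith
  · rw [e]
    refine hn.trans (le_of_eq ?_)
    congr 1; ring

end Rescale

theorem sineGordon_hasWeakCouplingKinks {c : ℝ} (hc : c ≠ 0) :
    HasWeakCouplingKinks Real.sin (-Real.pi) Real.pi c := by
  have hpi := Real.pi_pos
  refine hasWeakCouplingKinks_of_rescale (by linarith) hc (h1_rescale (G := fun v => -Real.cos v)
    Real.contDiff_sin (fun v => ?_) (by linarith) hc (by simp) (by simp) (by simp) (by simp)
    (by simp) fun v hv => ?_)
  · exact (Real.hasDerivAt_cos v).neg.congr_deriv (neg_neg _)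
  · have h := Real.cos_lt_cos_of_nonneg_of_le_pi (abs_nonneg v) le_rfl (abs_lt.2 hv)
    rw [Real.cos_abs, Real.cos_pi] at h
    simp only [Real.cos_neg, Real.cos_pi]
    linarith

theorem phi4_hasWeakCouplingKinks {c : ℝ} (hc : c ≠ 0) :
    HasWeakCouplingKinks (fun v => 2 * (v - v ^ 3)) (-1) 1 c := by
  have hd : ∀ v : ℝ, HasDerivAt (fun v : ℝ => 2 * (v - v ^ 3)) (2 * (1 - 3 * v ^ 2)) v :=
    fun v => (((hasDerivAt_id' v).sub (hasDerivAt_pow 3 v)).const_mul 2).congr_deriv (by simp)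
  refine hasWeakCouplingKinks_of_rescale (by norm_num) hc
    (h1_rescale (G := fun v => v ^ 2 - v ^ 4 / 2) (by fun_prop) (fun v => ?_) (by norm_num) hc
    (by norm_num) (by norm_num) (by rw [(hd _).deriv]; norm_num)
    (by rw [(hd _).deriv]; norm_num) (by norm_num) fun v hv => ?_)
  · exact ((hasDerivAt_pow 2 v).sub ((hasDerivAt_pow 4 v).div_const 2)).congr_deriv
      (by simp; ring)
  · have h1 : 0 < 1 - v ^ 2 := by nlinarith [hv.1, hv.2]
    have h2 := pow_pos h1 2
    refine ne_of_lt ?_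
    norm_num
    nlinarith

end Kink

end

theorem theorem1 :
    -- The general result: existence of the uncoupled kink and of the kinks near it.
    (∀ (f : ℝ → ℝ) (a : ℤ → ℝ), Kink.H1 f → Kink.H2 a →
      (∃ u₀ : ℝ → ℝ, Kink.IsHeteroclinic f 1 0 1 u₀) ∧
      ∀ u₀ : ℝ → ℝ, Kink.IsHeteroclinic f 1 0 1 u₀ →
        ∃ C > (0 : ℝ), ∃ ε₀ > (0 : ℝ), ∀ ε ∈ Set.Ioo 0 ε₀, ∃ u : ℝ → ℝ,
          Kink.SolvesNonlocal a f ε u ∧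
          Kink.MemH2 (fun z => u z - u₀ z) ∧
          Kink.h2Norm (fun z => u z - u₀ z) ≤ ENNReal.ofReal (C * ε) ∧
          Kink.Connects 0 1 u ∧
          Kink.SolvesLattice a f ε (Kink.wave 1 u)) ∧
    -- The discrete sine-Gordon lattice.
    (∀ c : ℝ, c ≠ 0 →
      Kink.HasWeakCouplingKinks Real.sin (-Real.pi) Real.pi c) ∧
    -- The lattice with the quartic double well potential.
    (∀ c : ℝ, c ≠ 0 →
      Kink.HasWeakCouplingKinks (fun v => 2 * (v - v ^ 3)) (-1) 1 c) := by
  refine ⟨fun f a hf ha => ⟨hf.exists_isHeteroclinic, fun u₀ hu₀ => ?_⟩,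
    fun c hc => Kink.sineGordon_hasWeakCouplingKinks hc,
    fun c hc => Kink.phi4_hasWeakCouplingKinks hc⟩
  obtain ⟨C, C0, ε₀, ε₀0, h⟩ := Kink.exists_kink_near hf ha hu₀
  refine ⟨C, C0, ε₀, ε₀0, fun ε hε => ?_⟩
  obtain ⟨u, h1, h2, h3, h4⟩ := h ε hε
  exact ⟨u, h1, h2, h3, h4, Kink.solvesLattice_wave h1⟩
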